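/- Work over $\mathbb{C}$. Let $X_{\mathsf{C}_2}\subset\mathbb{A}^{13}$ be the $\mathsf{C}_2$ cluster variety: the codimension $4$ affine variety with coordinates $\theta_i$, $\theta_{ij}=\theta_{ji}$, $A_i$, $A_{ij}=A_{ji}$ ($i\neq j$ in $\{1,2,3\}$) and $\lambda$, defined by the nine equations $$\theta_i\theta_j = A_{ij}\theta_{ij} + A_{jk}A_kA_{ki},\qquad \theta_{ki}\theta_{ij} = A_i\theta_i^2 + \lambda A_{jk}\theta_i + A_jA_{jk}^2A_k,\qquad \theta_i\theta_{jk} = A_{ij}A_j\theta_j + \lambda A_{ki}A_{ij} + A_kA_{ki}\theta_k,$$ where $(i,j,k)$ runs over the permutations of $(1,2,3)$. For integers $\rho_1,\rho_2,\rho_3,\rho_{12},\rho_{23},\rho_{31}$ (with $\rho_{ij}=\rho_{ji}$) grade the coordinates by $$d(\theta_i)=\rho_i,\quad d(\theta_{ij})=\rho_{ij},\quad d(A_i)=\rho_{ki}-2\rho_i+\rho_{ij},\quad d(A_{ij})=\rho_i-\rho_{ij}+\rho_j,\quad d(\lambda)=\rho_{12}+\rho_{23}+\rho_{31}-\rho_1-\rho_2-\rho_3,$$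 so that all nine equations are homogeneous. Let $\mathbb{C}[y_1,\dots,y_8]$ be graded by positive integers $a_1,\dots,a_8$, and let $\phi\colon\mathbb{A}^8\to\mathbb{A}^{13}$ be a morphism homogeneous of degree $0$, i.e. for each coordinate $v$ of $\mathbb{A}^{13}$ the polynomial $\phi^*(v)$ is zero or homogeneous of degree $d(v)$ (in particular $\phi^*(v)=0$ if $d(v)<0$). Assume also that $\phi^*(v)$ is a non-zero constant whenever $d(v)=0$. Let $\widehat Y:=\phi^{-1}(X_{\mathsf{C}_2})\subset\mathbb{A}^8$ be the scheme-theoretic inverse image, and suppose that - $\widehat Y$ is a regular pullback, i.e. it has codimension $4$ in $\mathbb{A}^8$; - $\widehat Y$ is the affine cone over a quasismooth $3$-fold in $\mathbb{P}(a_1,\dots,a_8)$, i.e. $\widehat Y$ is nonsingular away from the origin; - $\widehat Y$ is not a complete intersection in $\mathbb{A}^8$, i.e. its ideal is not generated by $4$ elements. Then $d(\theta_i)>0$ and $d(\theta_{ij})>0$ for all $i,j$, and one of the following holds: 1. ($\mathsf{C}_2$ format) $d(A_{ij})>0$ for all $i,j$, $d(\lambda)>0$, and $d(A_i)\geq 0$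 for all $i$. 2. ($\mathbb{P}^2\times\mathbb{P}^2$ format) $d(A_{ij})>0$ for all $i,j$, $d(\lambda)=0$, and either (a) $d(A_1)=d(A_2)=d(A_3)=0$, or (b) $d(A_i)<0$ for some $i$. 3. ($\mathsf{A}_2+\mathrm{CI}^{(1)}$ format) for some permutation $(i,j,k)$ of $(1,2,3)$, $d(A_{ij})=0$ and $d(A_i)$, $d(A_{jk})$, $d(A_{ki})$, $d(A_j)$, $d(\lambda)$ are all positive. -/

import Mathlib

open MvPolynomial

/-- The thirteen generators of the `C₂` cluster algebra.  Indices are read modulo `3`;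
`thetaE i`, `AE i` stand for the variables `θ_{i,i+1}`, `A_{i,i+1}` (the labels are unordered pairs),
so that `thetaE 0, thetaE 1, thetaE 2` are `θ₁₂, θ₂₃, θ₃₁` when `0, 1, 2 : Fin 3` stand for the
labels `1, 2, 3`. -/
inductive C2Var : Type
  | theta (i : Fin 3)
  | thetaE (i : Fin 3)
  | A (i : Fin 3)
  | AE (i : Fin 3)
  | lam
  deriving DecidableEq

namespace C2Var

/-- The nine equations of the `C₂` cluster variety. -/
inductive Rel : Type
  | vertex (i : Fin 3)
  | edge (i : Fin 3)
  | mixed (i : Fin 3)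

/-- The nine equations; with `j = i + 1`, `k = i + 2` one has
`AE i = A_{ij}`, `AE (i + 1) = A_{jk}`, `AE (i + 2) = A_{ki}`, and similarly for `thetaE`.
* `θ_i θ_j = A_{ij} θ_{ij} + A_{jk} A_k A_{ki}`;
* `θ_{ki} θ_{ij} = A_i θ_i² + λ A_{jk} θ_i + A_j A_{jk}² A_k`;
* `θ_i θ_{jk} = A_{ij} A_j θ_j + λ A_{ki} A_{ij} + A_k A_{ki} θ_k`. -/
noncomputable def equation : Rel → MvPolynomial C2Var ℂ
  | .vertex i => X (theta i) * X (theta (i + 1)) -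
      (X (AE i) * X (thetaE i) + X (AE (i + 1)) * X (A (i + 2)) * X (AE (i + 2)))
  | .edge i => X (thetaE (i + 2)) * X (thetaE i) -
      (X (A i) * X (theta i) ^ 2 + X lam * X (AE (i + 1)) * X (theta i)
        + X (A (i + 1)) * X (AE (i + 1)) ^ 2 * X (A (i + 2)))
  | .mixed i => X (theta i) * X (thetaE (i + 1)) -
      (X (AE i) * X (A (i + 1)) * X (theta (i + 1)) + X lam * X (AE (i + 2)) * X (AE i)
        + X (A (i + 2)) * X (AE (i + 2)) * X (theta (i + 2)))

/-- The degrees of the thirteen variables for the `ℤ`-grading given by a one parameter subgroup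
`(ρ_i, ρ_{i,i+1})` of the torus `𝕋⁶`; here `ρ i = ρ_i` and `ρE i = ρ_{i,i+1}`. -/
def degree (ρ ρE : Fin 3 → ℤ) : C2Var → ℤ
  | theta i => ρ i
  | thetaE i => ρE i
  | A i => ρE (i + 2) - 2 * ρ i + ρE i
  | AE i => ρ i - ρE i + ρ (i + 1)
  | lam => ∑ i, ρE i - ∑ i, ρ i

end C2Var

/-- The ideal of the scheme-theoretic inverse image `φ⁻¹(X_{C₂}) ⊆ 𝔸ⁿ` of the `C₂` cluster variety
under the morphism `φ : 𝔸ⁿ → 𝔸¹³` whose components are the polynomials `φ v = φ^*(v)`. -/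
noncomputable def c2PullbackIdeal {n : ℕ} (φ : C2Var → MvPolynomial (Fin n) ℂ) :
    Ideal (MvPolynomial (Fin n) ℂ) :=
  Ideal.span (Set.range fun r => aeval φ (C2Var.equation r))

/-- `φ⁻¹(X_{C₂})` is a regular pullback: it has codimension `4 = codim X_{C₂}`. -/
def IsC2RegularPullback {n : ℕ} (φ : C2Var → MvPolynomial (Fin n) ℂ) : Prop :=
  (c2PullbackIdeal φ).height = 4

/-- `V(I) ⊆ 𝔸ⁿ` is a complete intersection: for some `c` the ideal `I` has codimension `c` and is
generated by `c` elements. -/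
def IsCompleteIntersectionIdeal {n : ℕ} (I : Ideal (MvPolynomial (Fin n) ℂ)) : Prop :=
  ∃ (c : ℕ) (f : Fin c → MvPolynomial (Fin n) ℂ), I.height = c ∧ I = Ideal.span (Set.range f)

/-- The affine cone `V(I) ⊆ 𝔸ⁿ` is nonsingular away from its vertex (the origin): the local ring at
every closed point other than the origin is regular. -/
def IsNonsingularOutsideVertex {n : ℕ} (I : Ideal (MvPolynomial (Fin n) ℂ)) : Prop :=
  ∀ (m : Ideal (MvPolynomial (Fin n) ℂ ⧸ I)) [m.IsMaximal],
    m.comap (Ideal.Quotient.mk I) ≠ Ideal.span (Set.range X) →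
      IsRegularLocalRing (Localization.AtPrime m)

open C2Var

/-! Two mechanisms exclude every other sign pattern of the degrees.

Degree zero: since all weights are positive, `φ v` is then a non-zero constant, hence a unit. Some
of the nine equations can be solved using this unit, and in the forbidden cases four of them imply
the rest. As the ideal has height 4, it would be a complete intersection
(`false_of_four_generators`).

Negative degree: `φ v` is then zero. Seven further polynomials without constant term have a common
zero `p ≠ 0` in 8-space. They are chosen so that at `p` all but three equations vanish to second
order. The Jacobian then has rank at most 3, below the codimension 4, and `p` is a singular point
(`false_of_singular_locus`).

If no `A_ij` has degree zero, these arguments make all `θ_i`, `θ_ij`, `A_ij` positive, and `d(A_i) ≥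
0` unless `d(λ) = 0`. The identity `∑ d(A_i) = 2 d(λ)` separates the first two formats. If `A_12` is
a unit, one equation eliminates `θ_12` and the others reduce to the Pfaffians of a 5 × 5 skew
matrix, to whose entries the same two mechanisms apply. -/

/-! ### Heights and common zeros in affine space. -/

/-- Passing to the quotient by an ideal of height at least `c` lowers the height of primes by `c`. -/
lemma Ideal.height_le_of_height_comap_mk_le {R : Type*} [CommRing R] {I : Ideal R} {c : ℕ}
    (hI : (c : ℕ∞) ≤ I.height) (n : ℕ) (q : Ideal (R ⧸ I)) [q.IsPrime]
    (hq : (q.comap (Ideal.Quotient.mk I)).height ≤ (n + c : ℕ)) : q.height ≤ n := by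
  induction n generalizing q with
  | zero =>
    rw [Ideal.height_le_iff] at hq ⊢
    intro q' hq' hlt
    have h1 := hq (q'.comap (Ideal.Quotient.mk I)) inferInstance
      ((Ideal.orderEmbeddingOfSurjective _ Ideal.Quotient.mk_surjective).strictMono hlt)
    have h2 : I ≤ q'.comap (Ideal.Quotient.mk I) := by
      conv_lhs => rw [← Ideal.mk_ker (I := I)]
      exact Ideal.ker_le_comap _
    have h3 := hI.trans (Ideal.height_mono h2)
    simp only [zero_add] at h1
    exact absurd h1 (not_lt.mpr h3)
  | succ n ih =>
    rw [Ideal.height_le_iff] at hq ⊢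
    intro q' hq' hlt
    have h1 := hq (q'.comap (Ideal.Quotient.mk I)) inferInstance
      ((Ideal.orderEmbeddingOfSurjective _ Ideal.Quotient.mk_surjective).strictMono hlt)
    have h2 := ih q' (by
      have : ((n + 1 + c : ℕ) : ℕ∞) = ((n + c : ℕ) : ℕ∞) + 1 := by push_cast; ring
      rw [this] at h1
      exact Order.le_of_lt_add_one h1)
    refine lt_of_le_of_lt h2 ?_
    exact_mod_cast Nat.lt_succ_self n

lemma MvPolynomial.ringKrullDim_fin {K : Type*} [Field K] (n : ℕ) :
    ringKrullDim (MvPolynomial (Fin n) K) = n := by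
  rw [MvPolynomial.ringKrullDim_of_isNoetherianRing]
  simp

/-- The maximal ideal of the point `p` of affine space. -/
noncomputable def pointIdeal {n : ℕ} (p : Fin n → ℂ) : Ideal (MvPolynomial (Fin n) ℂ) :=
  RingHom.ker (eval p)

lemma mem_pointIdeal {n : ℕ} {p : Fin n → ℂ} {f : MvPolynomial (Fin n) ℂ} :
    f ∈ pointIdeal p ↔ eval p f = 0 := RingHom.mem_ker

instance {n : ℕ} (p : Fin n → ℂ) : (pointIdeal p).IsMaximal :=
  RingHom.ker_isMaximal_of_surjective _ (fun c => ⟨C c, by simp⟩)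

/-- Translation by `p`. -/
noncomputable def pointTranslation {n : ℕ} (p : Fin n → ℂ) :
    MvPolynomial (Fin n) ℂ ≃ₐ[ℂ] MvPolynomial (Fin n) ℂ :=
  AlgEquiv.ofAlgHom (aeval fun i => X i + C (p i)) (aeval fun i => X i - C (p i))
    (by ext i; simp) (by ext i; simp)

/-- Some maximal ideal attains the Krull dimension; by the Nullstellensatz it is the ideal of a
point, and a translation moves that point to the origin. -/
lemma height_pointIdeal_zero (n : ℕ) : (pointIdeal (0 : Fin n → ℂ)).height = n := by
  have hdim := MvPolynomial.ringKrullDim_fin (K := ℂ) n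
  have : FiniteRingKrullDim (MvPolynomial (Fin n) ℂ) := by
    rw [finiteRingKrullDim_iff_ne_bot_and_top, hdim]
    exact ⟨WithBot.natCast_ne_bot n, fun h => ENat.natCast_ne_top n (WithBot.coe_injective h)⟩
  obtain ⟨P, hP, hh⟩ := Ideal.exists_isMaximal_height (R := MvPolynomial (Fin n) ℂ)
  rw [hdim] at hh
  obtain ⟨p, rfl⟩ := (MvPolynomial.isMaximal_iff_eq_vanishingIdeal_singleton (σ := Fin n) (K := ℂ)).1 hP
  have h1 : (vanishingIdeal ℂ {p}).comap (pointTranslation (-p)).toRingEquiv = pointIdeal 0 := by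
    ext f
    rw [Ideal.mem_comap, mem_vanishingIdeal_singleton_iff, mem_pointIdeal]
    have h : (eval p).comp (pointTranslation (-p)).toRingEquiv.toRingHom = eval 0 :=
      MvPolynomial.ringHom_ext (by simp [pointTranslation]) (by simp [pointTranslation])
    rw [← h]
    simp [MvPolynomial.aeval_eq_eval]
  rw [← h1, RingEquiv.height_comap]
  exact_mod_cast hh

/-- If the origin were the only common zero, its ideal would be a minimal prime over an ideal with
`k` generators, so by Krull's height theorem it would have height at most `k < n`. -/
lemma exists_common_zero_ne_zero {n k : ℕ} (hk : k < n) (g : Fin k → MvPolynomial (Fin n) ℂ)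
    (hg : ∀ i, eval 0 (g i) = 0) : ∃ p : Fin n → ℂ, p ≠ 0 ∧ ∀ i, eval p (g i) = 0 := by
  by_contra hcon
  push Not at hcon
  have hle : Ideal.span (Set.range g) ≤ pointIdeal 0 := by
    rw [Ideal.span_le]
    rintro _ ⟨i, rfl⟩
    exact mem_pointIdeal.2 (hg i)
  have hmin : pointIdeal 0 ∈ (Ideal.span (Set.range g)).minimalPrimes := by
    refine ⟨⟨inferInstance, hle⟩, ?_⟩
    rintro Q ⟨hQ, hQle⟩ -
    -- By the Nullstellensatz the radical of the span contains the whole ideal of the origin, which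
    -- gives minimality.
    have h1 : pointIdeal (0 : Fin n → ℂ) ≤ (Ideal.span (Set.range g)).radical := by
      rw [← MvPolynomial.vanishingIdeal_zeroLocus_eq_radical (K := ℂ)]
      intro f hf
      rw [mem_vanishingIdeal_iff]
      intro x hx
      have hx0 : x = 0 := by
        by_contra hne
        obtain ⟨i, hi⟩ := hcon x hne
        exact hi (by simpa [MvPolynomial.aeval_eq_eval] using hx (g i) (Ideal.subset_span ⟨i, rfl⟩))
      subst hx0
      simpa using mem_pointIdeal.1 hf
    exact h1.trans ((Ideal.radical_mono hQle).trans_eq hQ.radical)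
  have h2 := Ideal.height_le_card_of_mem_minimalPrimes_span (Set.finite_range g) hmin
  rw [height_pointIdeal_zero] at h2
  have h3 : (Set.range g).ncard ≤ k := by
    rw [← Set.image_univ]
    exact (Set.ncard_image_le Set.finite_univ).trans (by simp [Set.ncard_univ])
  have h4 : n ≤ (Set.range g).ncard := by exact_mod_cast h2
  omega

/-! ### Gradients and the Jacobian criterion. -/

/-- The gradient at the point `p`. -/
noncomputable def gradientAt {n : ℕ} (p : Fin n → ℂ) : MvPolynomial (Fin n) ℂ →ₗ[ℂ] (Fin n → ℂ) :=
  LinearMap.pi fun i => (aeval p).toLinearMap ∘ₗ (pderiv i).toLinearMap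

lemma gradientAt_apply {n : ℕ} (p : Fin n → ℂ) (f : MvPolynomial (Fin n) ℂ) (i : Fin n) :
    gradientAt p f i = eval p (pderiv i f) := by
  simp [gradientAt, MvPolynomial.aeval_eq_eval]

lemma gradientAt_mul {n : ℕ} (p : Fin n → ℂ) (f g : MvPolynomial (Fin n) ℂ) :
    gradientAt p (f * g) = eval p f • gradientAt p g + eval p g • gradientAt p f := by
  ext i
  simp [gradientAt_apply]

/-- The polynomials vanishing at `p` whose gradient at `p` lies in the subspace `T`. -/
noncomputable def idealOfGradients {n : ℕ} (p : Fin n → ℂ) (T : Submodule ℂ (Fin n → ℂ)) :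
    Ideal (MvPolynomial (Fin n) ℂ) where
  carrier := {f | eval p f = 0 ∧ gradientAt p f ∈ T}
  add_mem' := fun hf hg => ⟨by simp [hf.1, hg.1], by simpa using T.add_mem hf.2 hg.2⟩
  zero_mem' := by simp
  smul_mem' := fun c f hf => ⟨by simp [hf.1], by
    rw [smul_eq_mul, gradientAt_mul, hf.1, zero_smul, add_zero]
    exact T.smul_mem _ hf.2⟩

/-- Easy half of the Jacobian criterion: if `I` has height at least `c` and its gradients at a point
`p ≠ 0` span a space of dimension less than `c`, then `V(I)` is singular at `p`. -/
lemma not_isNonsingularOutsideVertex {n c k : ℕ} (I : Ideal (MvPolynomial (Fin n) ℂ))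
    (hI : (c : ℕ∞) ≤ I.height) (hk : k < c) (p : Fin n → ℂ) (hp : p ≠ 0)
    (h : Fin k → MvPolynomial (Fin n) ℂ)
    (hle : I ≤ idealOfGradients p (Submodule.span ℂ (Set.range fun i => gradientAt p (h i)))) :
    ¬ IsNonsingularOutsideVertex I := by
  intro hns
  have hIp : I ≤ pointIdeal p := fun f hf => mem_pointIdeal.2 (hle hf).1
  have hcomap : ((pointIdeal p).map (Ideal.Quotient.mk I)).comap (Ideal.Quotient.mk I)
      = pointIdeal p := by
    rw [Ideal.comap_map_of_surjective _ Ideal.Quotient.mk_surjective]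
    simpa [← RingHom.ker_eq_comap_bot] using hIp
  have hmax : ((pointIdeal p).map (Ideal.Quotient.mk I)).IsMaximal := by
    refine (Ideal.map_eq_top_or_isMaximal_of_surjective _ Ideal.Quotient.mk_surjective
      inferInstance).resolve_left fun htop => ?_
    rw [htop, Ideal.comap_top] at hcomap
    exact (inferInstance : (pointIdeal p).IsMaximal).ne_top hcomap.symm
  generalize (pointIdeal p).map (Ideal.Quotient.mk I) = m at hcomap hmax
  have hreg := hns m (by
    rw [hcomap]
    intro heq
    apply hp
    ext i
    have : (X i : MvPolynomial (Fin n) ℂ) ∈ pointIdeal p := heq ▸ Ideal.subset_span ⟨i, rfl⟩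
    simpa using mem_pointIdeal.1 this)
  have hmemm : ∀ f, Ideal.Quotient.mk I f ∈ m ↔ eval p f = 0 := by
    intro f
    rw [← mem_pointIdeal, ← hcomap, Ideal.mem_comap]
  have hpn : (pointIdeal p).height ≤ n := by
    have := Ideal.height_le_ringKrullDim_of_isPrime (I := pointIdeal p)
    rw [MvPolynomial.ringKrullDim_fin] at this
    exact_mod_cast this
  have hcn : c ≤ n := by exact_mod_cast hI.trans ((Ideal.height_mono hIp).trans hpn)
  -- Regularity bounds the number of generators of the maximal ideal by the dimension of the local
  -- ring, itself at most `n - c`.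
  have hdim : (IsLocalRing.maximalIdeal (Localization.AtPrime m)).spanFinrank ≤ n - c := by
    have h1 := hreg.spanFinrank_maximalIdeal
    rw [IsLocalization.AtPrime.ringKrullDim_eq_height m] at h1
    have h2 := Ideal.height_le_of_height_comap_mk_le hI (n - c) m (by
      rw [hcomap, Nat.sub_add_cancel hcn]; exact hpn)
    have h3 : ((IsLocalRing.maximalIdeal (Localization.AtPrime m)).spanFinrank :
      ℕ∞) = m.height := by
      exact_mod_cast h1
    rw [← h3] at h2
    exact_mod_cast h2
  obtain ⟨s, hs, hspan⟩ := (IsNoetherian.noetherian (IsLocalRing.maximalIdeal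
    (Localization.AtPrime m))).exists_span_finset_card_eq_spanFinrank
  have hnum : ∀ e : Localization.AtPrime m, ∃ x : MvPolynomial (Fin n) ℂ, ∃ t : m.primeCompl,
      e * algebraMap _ _ (t : MvPolynomial (Fin n) ℂ ⧸ I)
        = algebraMap _ _ (Ideal.Quotient.mk I x) := by
    intro e
    obtain ⟨⟨x, t⟩, hxt⟩ := IsLocalization.surj m.primeCompl e
    obtain ⟨x, rfl⟩ := Ideal.Quotient.mk_surjective x
    exact ⟨x, t, hxt⟩
  choose x t hxt using hnum
  -- `T` is spanned by the `k` given gradients and those of numerators of at most `n - c`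
  -- generators. Showing `T = ⊤` will force `n ≤ k + (n - c) < n`.
  set T : Submodule ℂ (Fin n → ℂ) := Submodule.span ℂ
    ((Set.range fun i => gradientAt p (h i)) ∪ (s.image fun e => gradientAt p (x e) : Finset _))
    with hT
  have hIK : I ≤ idealOfGradients p T := fun f hf =>
    ⟨(hle hf).1, Submodule.span_mono Set.subset_union_left (hle hf).2⟩
  have hsK : Ideal.span (s : Set (Localization.AtPrime m)) ≤
      ((idealOfGradients p T).map (Ideal.Quotient.mk I)).map (algebraMap _ _) := by
    rw [Ideal.span_le]
    intro e he
    have hmem : e ∈ IsLocalRing.maximalIdeal (Localization.AtPrime m) :=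
      hspan ▸ Submodule.subset_span he
    have hx0 : eval p (x e) = 0 := by
      rw [← hmemm, ← IsLocalization.AtPrime.to_map_mem_maximal_iff (Localization.AtPrime m) m,
        ← hxt]
      exact Ideal.mul_mem_right _ _ hmem
    have hxK : x e ∈ idealOfGradients p T :=
      ⟨hx0, Submodule.subset_span (Or.inr (by
        rw [Finset.mem_coe, Finset.mem_image]; exact ⟨e, he, rfl⟩))⟩
    have h1 := Ideal.mem_map_of_mem (algebraMap _ (Localization.AtPrime m))
      (Ideal.mem_map_of_mem (Ideal.Quotient.mk I) hxK)
    rw [← hxt] at h1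
    exact (Ideal.mul_unit_mem_iff_mem _ (IsLocalization.map_units _ (t e))).1 h1
  have hgrad : ∀ f, eval p f = 0 → gradientAt p f ∈ T := by
    intro f hf
    have h1 : algebraMap _ (Localization.AtPrime m) (Ideal.Quotient.mk I f) ∈
        IsLocalRing.maximalIdeal (Localization.AtPrime m) := by
      rw [IsLocalization.AtPrime.to_map_mem_maximal_iff (Localization.AtPrime m) m, hmemm, hf]
    rw [← hspan] at h1
    obtain ⟨⟨⟨b, hb⟩, v⟩, hv⟩ :=
      (IsLocalization.mem_map_algebraMap_iff m.primeCompl _).1 (hsK h1)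
    rw [← map_mul] at hv
    obtain ⟨u, hu⟩ := IsLocalization.exists_of_eq (M := m.primeCompl) hv
    obtain ⟨u, hum⟩ := u
    obtain ⟨v, hvm⟩ := v
    obtain ⟨u, rfl⟩ := Ideal.Quotient.mk_surjective u
    obtain ⟨v, rfl⟩ := Ideal.Quotient.mk_surjective v
    -- After clearing denominators, `u * v * f` has gradient in `T`. As `f` vanishes at `p`, this
    -- gradient is the non-zero scalar `u(p) v(p)` times that of `f`.
    have h2 : Ideal.Quotient.mk I (u * v * f) ∈
        (idealOfGradients p T).map (Ideal.Quotient.mk I) := by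
      have : Ideal.Quotient.mk I (u * v * f) = Ideal.Quotient.mk I u * b := by
        rw [← hu]; simp only [map_mul]; ring
      rw [this]
      exact Ideal.mul_mem_left _ _ hb
    rw [← Ideal.mem_comap, Ideal.comap_map_of_surjective _ Ideal.Quotient.mk_surjective,
      ← RingHom.ker_eq_comap_bot, Ideal.mk_ker, sup_eq_left.2 hIK] at h2
    have h3 := h2.2
    rw [gradientAt_mul, hf, zero_smul, add_zero] at h3
    refine (Submodule.smul_mem_iff _ ?_).1 h3
    rw [map_mul]
    exact mul_ne_zero (fun h0 => hum ((hmemm u).2 h0)) (fun h0 => hvm ((hmemm v).2 h0))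
  have htop : T = ⊤ := by
    rw [eq_top_iff, ← (Pi.basisFun ℂ (Fin n)).span_eq, Submodule.span_le]
    rintro _ ⟨j, rfl⟩
    have h1 := hgrad (X j - C (p j)) (by simp)
    have h2 : Pi.basisFun ℂ (Fin n) j = gradientAt p (X j - C (p j)) := by
      ext i
      simp [gradientAt_apply, pderiv_X, Pi.single_apply, eq_comm]
    rw [h2]
    exact h1
  have hfin : Module.finrank ℂ T ≤ k + s.card := by
    classical
    have h1 : (Set.range fun i => gradientAt p (h i)) =
        ((Finset.univ.image fun i => gradientAt p (h i) : Finset (Fin n → ℂ)) : Set _) := by simp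
    rw [hT, h1, ← Finset.coe_union]
    refine (finrank_span_finset_le_card _).trans ((Finset.card_union_le _ _).trans ?_)
    refine Nat.add_le_add (Finset.card_image_le.trans (by simp)) Finset.card_image_le
  rw [htop, finrank_top, Module.finrank_fin_fun] at hfin
  omega

/-! ### Redundancy among the equations when a variable is a unit. -/

/-- Where `θ_1` is invertible the variety is a graph: the four hypotheses solve for `θ_2`, `θ_3`,
`A_1` and `θ_23`. -/
lemma relations_of_theta_unit {R : Type*} [CommRing R]
    {u t1 t2 t3 t12 t23 t31 a1 a2 a3 a12 a23 a31 l : R}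
    (hu : u * t1 = 1)
    (v12 : t1 * t2 - (a12 * t12 + a23 * a3 * a31) = 0)
    (v31 : t3 * t1 - (a31 * t31 + a12 * a2 * a23) = 0)
    (e1 : t31 * t12 - (a1 * t1 ^ 2 + l * a23 * t1 + a2 * a23 ^ 2 * a3) = 0)
    (m1 : t1 * t23 - (a12 * a2 * t2 + l * a31 * a12 + a3 * a31 * t3) = 0) :
    t2 * t3 - (a23 * t23 + a31 * a1 * a12) = 0 ∧
    t12 * t23 - (a2 * t2 ^ 2 + l * a31 * t2 + a3 * a31 ^ 2 * a1) = 0 ∧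
    t23 * t31 - (a3 * t3 ^ 2 + l * a12 * t3 + a1 * a12 ^ 2 * a2) = 0 ∧
    t2 * t31 - (a23 * a3 * t3 + l * a12 * a23 + a1 * a12 * t1) = 0 ∧
    t3 * t12 - (a31 * a1 * t1 + l * a23 * a31 + a2 * a23 * t2) = 0 := by
  refine ⟨?_, ?_, ?_, ?_, ?_⟩ <;> grind

/-- Here the four hypotheses solve for `A_12`, `θ_31`, `θ_23` and `θ_3`. -/
lemma relations_of_thetaE_unit {R : Type*} [CommRing R]
    {u t1 t2 t3 t12 t23 t31 a1 a2 a3 a12 a23 a31 l : R}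
    (hu : u * t12 = 1)
    (v12 : t1 * t2 - (a12 * t12 + a23 * a3 * a31) = 0)
    (e1 : t31 * t12 - (a1 * t1 ^ 2 + l * a23 * t1 + a2 * a23 ^ 2 * a3) = 0)
    (e2 : t12 * t23 - (a2 * t2 ^ 2 + l * a31 * t2 + a3 * a31 ^ 2 * a1) = 0)
    (m3 : t3 * t12 - (a31 * a1 * t1 + l * a23 * a31 + a2 * a23 * t2) = 0) :
    t2 * t3 - (a23 * t23 + a31 * a1 * a12) = 0 ∧
    t3 * t1 - (a31 * t31 + a12 * a2 * a23) = 0 ∧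
    t23 * t31 - (a3 * t3 ^ 2 + l * a12 * t3 + a1 * a12 ^ 2 * a2) = 0 ∧
    t1 * t23 - (a12 * a2 * t2 + l * a31 * a12 + a3 * a31 * t3) = 0 ∧
    t2 * t31 - (a23 * a3 * t3 + l * a12 * a23 + a1 * a12 * t1) = 0 := by
  refine ⟨?_, ?_, ?_, ?_, ?_⟩ <;> grind

lemma relations_of_AE_unit {R : Type*} [CommRing R]
    {u t1 t2 t3 t12 t23 t31 a1 a2 a3 a12 a23 a31 l : R}
    (hu : u * a12 = 1)
    (v12 : t1 * t2 - (a12 * t12 + a23 * a3 * a31) = 0)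
    (v23 : t2 * t3 - (a23 * t23 + a31 * a1 * a12) = 0)
    (v31 : t3 * t1 - (a31 * t31 + a12 * a2 * a23) = 0)
    (m1 : t1 * t23 - (a12 * a2 * t2 + l * a31 * a12 + a3 * a31 * t3) = 0)
    (m2 : t2 * t31 - (a23 * a3 * t3 + l * a12 * a23 + a1 * a12 * t1) = 0) :
    t31 * t12 - (a1 * t1 ^ 2 + l * a23 * t1 + a2 * a23 ^ 2 * a3) = 0 ∧
    t12 * t23 - (a2 * t2 ^ 2 + l * a31 * t2 + a3 * a31 ^ 2 * a1) = 0 ∧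
    t3 * t12 - (a31 * a1 * t1 + l * a23 * a31 + a2 * a23 * t2) = 0 := by
  refine ⟨?_, ?_, ?_⟩ <;> grind

/-- Every entry of a 5 × 5 skew matrix occurs in three of its five Pfaffians. If it is a unit, these
three generate the other two. Here the entry is `A_23`; the next two lemmas use `A_1 A_12` and `λ
A_12 + A_3 θ_3`. -/
lemma relations_of_two_AE_units {R : Type*} [CommRing R]
    {w t1 t2 t3 t23 t31 a1 a2 a3 a12 a23 a31 l : R}
    (hw : w * a23 = 1)
    (v23 : t2 * t3 - (a23 * t23 + a31 * a1 * a12) = 0)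
    (v31 : t3 * t1 - (a31 * t31 + a12 * a2 * a23) = 0)
    (m2 : t2 * t31 - (a23 * a3 * t3 + l * a12 * a23 + a1 * a12 * t1) = 0) :
    t1 * t23 - (a12 * a2 * t2 + l * a31 * a12 + a3 * a31 * t3) = 0 ∧
    t23 * t31 - (a3 * t3 ^ 2 + l * a12 * t3 + a1 * a12 ^ 2 * a2) = 0 := by
  constructor <;> grind

lemma relations_of_AE_unit_of_A_unit {R : Type*} [CommRing R]
    {u w t1 t2 t3 t23 t31 a1 a2 a3 a12 a23 a31 l : R}
    (hu : u * a12 = 1) (hw : w * a1 = 1)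
    (v23 : t2 * t3 - (a23 * t23 + a31 * a1 * a12) = 0)
    (m2 : t2 * t31 - (a23 * a3 * t3 + l * a12 * a23 + a1 * a12 * t1) = 0)
    (e3 : t23 * t31 - (a3 * t3 ^ 2 + l * a12 * t3 + a1 * a12 ^ 2 * a2) = 0) :
    t3 * t1 - (a31 * t31 + a12 * a2 * a23) = 0 ∧
    t1 * t23 - (a12 * a2 * t2 + l * a31 * a12 + a3 * a31 * t3) = 0 := by
  constructor <;> grind

lemma relations_of_AE_unit_of_lam_unit {R : Type*} [CommRing R]
    {u w t1 t2 t3 t23 t31 a1 a2 a3 a12 a23 a31 l : R}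
    (hu : u * a12 = 1) (hw : w * (l * a12 + a3 * t3) = 1)
    (m1 : t1 * t23 - (a12 * a2 * t2 + l * a31 * a12 + a3 * a31 * t3) = 0)
    (m2 : t2 * t31 - (a23 * a3 * t3 + l * a12 * a23 + a1 * a12 * t1) = 0)
    (e3 : t23 * t31 - (a3 * t3 ^ 2 + l * a12 * t3 + a1 * a12 ^ 2 * a2) = 0) :
    t2 * t3 - (a23 * t23 + a31 * a1 * a12) = 0 ∧
    t3 * t1 - (a31 * t31 + a12 * a2 * a23) = 0 := by
  constructor <;> grind


/-! ### The nine equations written out. -/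

section Equations

variable {B : Type*} [CommRing B] [Algebra ℂ B] (x : C2Var → B)

lemma aeval_equation_vertex_zero : aeval x (equation (.vertex 0)) =
    x (theta 0) * x (theta 1) -
      (x (AE 0) * x (thetaE 0) + x (AE 1) * x (A 2) * x (AE 2)) := by
  simp only [equation, map_sub, map_add, map_mul, aeval_X]
  rfl

lemma aeval_equation_vertex_one : aeval x (equation (.vertex 1)) =
    x (theta 1) * x (theta 2) -
      (x (AE 1) * x (thetaE 1) + x (AE 2) * x (A 0) * x (AE 0)) := by
  simp only [equation, map_sub, map_add, map_mul, aeval_X]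
  rfl

lemma aeval_equation_vertex_two : aeval x (equation (.vertex 2)) =
    x (theta 2) * x (theta 0) -
      (x (AE 2) * x (thetaE 2) + x (AE 0) * x (A 1) * x (AE 1)) := by
  simp only [equation, map_sub, map_add, map_mul, aeval_X]
  rfl

lemma aeval_equation_edge_zero : aeval x (equation (.edge 0)) =
    x (thetaE 2) * x (thetaE 0) -
      (x (A 0) * x (theta 0) ^ 2 + x lam * x (AE 1) * x (theta 0)
        + x (A 1) * x (AE 1) ^ 2 * x (A 2)) := by
  simp only [equation, map_sub, map_add, map_mul, map_pow, aeval_X]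
  rfl

lemma aeval_equation_edge_one : aeval x (equation (.edge 1)) =
    x (thetaE 0) * x (thetaE 1) -
      (x (A 1) * x (theta 1) ^ 2 + x lam * x (AE 2) * x (theta 1)
        + x (A 2) * x (AE 2) ^ 2 * x (A 0)) := by
  simp only [equation, map_sub, map_add, map_mul, map_pow, aeval_X]
  rfl

lemma aeval_equation_edge_two : aeval x (equation (.edge 2)) =
    x (thetaE 1) * x (thetaE 2) -
      (x (A 2) * x (theta 2) ^ 2 + x lam * x (AE 0) * x (theta 2)
        + x (A 0) * x (AE 0) ^ 2 * x (A 1)) := by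
  simp only [equation, map_sub, map_add, map_mul, map_pow, aeval_X]
  rfl

lemma aeval_equation_mixed_zero : aeval x (equation (.mixed 0)) =
    x (theta 0) * x (thetaE 1) -
      (x (AE 0) * x (A 1) * x (theta 1) + x lam * x (AE 2) * x (AE 0)
        + x (A 2) * x (AE 2) * x (theta 2)) := by
  simp only [equation, map_sub, map_add, map_mul, aeval_X]
  rfl

lemma aeval_equation_mixed_one : aeval x (equation (.mixed 1)) =
    x (theta 1) * x (thetaE 2) -
      (x (AE 1) * x (A 2) * x (theta 2) + x lam * x (AE 0) * x (AE 1)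
        + x (A 0) * x (AE 0) * x (theta 0)) := by
  simp only [equation, map_sub, map_add, map_mul, aeval_X]
  rfl

lemma aeval_equation_mixed_two : aeval x (equation (.mixed 2)) =
    x (theta 2) * x (thetaE 0) -
      (x (AE 2) * x (A 0) * x (theta 0) + x lam * x (AE 1) * x (AE 2)
        + x (A 1) * x (AE 1) * x (theta 1)) := by
  simp only [equation, map_sub, map_add, map_mul, aeval_X]
  rfl

lemma forall_aeval_equation {P : B → Prop}
    (v0 : P (x (theta 0) * x (theta 1) -
      (x (AE 0) * x (thetaE 0) + x (AE 1) * x (A 2) * x (AE 2))))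
    (v1 : P (x (theta 1) * x (theta 2) -
      (x (AE 1) * x (thetaE 1) + x (AE 2) * x (A 0) * x (AE 0))))
    (v2 : P (x (theta 2) * x (theta 0) -
      (x (AE 2) * x (thetaE 2) + x (AE 0) * x (A 1) * x (AE 1))))
    (e0 : P (x (thetaE 2) * x (thetaE 0) -
      (x (A 0) * x (theta 0) ^ 2 + x lam * x (AE 1) * x (theta 0)
        + x (A 1) * x (AE 1) ^ 2 * x (A 2))))
    (e1 : P (x (thetaE 0) * x (thetaE 1) -
      (x (A 1) * x (theta 1) ^ 2 + x lam * x (AE 2) * x (theta 1)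
        + x (A 2) * x (AE 2) ^ 2 * x (A 0))))
    (e2 : P (x (thetaE 1) * x (thetaE 2) -
      (x (A 2) * x (theta 2) ^ 2 + x lam * x (AE 0) * x (theta 2)
        + x (A 0) * x (AE 0) ^ 2 * x (A 1))))
    (m0 : P (x (theta 0) * x (thetaE 1) -
      (x (AE 0) * x (A 1) * x (theta 1) + x lam * x (AE 2) * x (AE 0)
        + x (A 2) * x (AE 2) * x (theta 2))))
    (m1 : P (x (theta 1) * x (thetaE 2) -
      (x (AE 1) * x (A 2) * x (theta 2) + x lam * x (AE 0) * x (AE 1)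
        + x (A 0) * x (AE 0) * x (theta 0))))
    (m2 : P (x (theta 2) * x (thetaE 0) -
      (x (AE 2) * x (A 0) * x (theta 0) + x lam * x (AE 1) * x (AE 2)
        + x (A 1) * x (AE 1) * x (theta 1)))) :
    ∀ r, P (aeval x (equation r)) := by
  rintro (i | i | i) <;> fin_cases i
  · exact (aeval_equation_vertex_zero x).symm ▸ v0
  · exact (aeval_equation_vertex_one x).symm ▸ v1
  · exact (aeval_equation_vertex_two x).symm ▸ v2
  · exact (aeval_equation_edge_zero x).symm ▸ e0
  · exact (aeval_equation_edge_one x).symm ▸ e1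
  · exact (aeval_equation_edge_two x).symm ▸ e2
  · exact (aeval_equation_mixed_zero x).symm ▸ m0
  · exact (aeval_equation_mixed_one x).symm ▸ m1
  · exact (aeval_equation_mixed_two x).symm ▸ m2

end Equations

/-! ### Symmetries, homogeneity and the two sources of contradiction. -/

/-- The cyclic permutation of the labels by `m` places. -/
def C2Var.shift (m : Fin 3) : C2Var → C2Var
  | theta i => theta (i + m)
  | thetaE i => thetaE (i + m)
  | A i => A (i + m)
  | AE i => AE (i + m)
  | lam => lam

/-- The transposition of the first two labels. -/
def C2Var.reflect : C2Var → C2Var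
  | theta i => theta (1 - i)
  | thetaE i => thetaE (-i)
  | A i => A (1 - i)
  | AE i => AE (-i)
  | lam => lam

/-- A quasismooth regular pullback of the `C₂` cluster variety which is not a complete intersection. -/
structure IsQuasismoothC2Pullback (a : Fin 8 → ℕ) (ρ ρE : Fin 3 → ℤ)
    (φ : C2Var → MvPolynomial (Fin 8) ℂ) : Prop where
  weight_pos : ∀ s, 0 < a s
  homogeneous : ∀ v, IsWeightedHomogeneous (fun s => (a s : ℤ)) (φ v) (degree ρ ρE v)
  ne_zero : ∀ v, degree ρ ρE v = 0 → φ v ≠ 0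
  regular : IsC2RegularPullback φ
  nonsingular : IsNonsingularOutsideVertex (c2PullbackIdeal φ)
  not_ci : ¬ IsCompleteIntersectionIdeal (c2PullbackIdeal φ)

section Homogeneous

variable {σ : Type*} {a : σ → ℕ} {f : MvPolynomial σ ℂ} {d : ℤ}

lemma weight_natCast_nonneg (a : σ → ℕ) (c : σ →₀ ℕ) : 0 ≤ Finsupp.weight (fun s => (a s :
    ℤ)) c := by
  rw [Finsupp.weight_apply]
  exact Finset.sum_nonneg fun i _ => by positivity

lemma eq_zero_of_degree_neg (hf : IsWeightedHomogeneous (fun s => (a s : ℤ)) f d) (hd : d < 0) :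
    f = 0 := by
  ext c
  by_contra hc
  have := hf hc
  have := weight_natCast_nonneg a c
  omega

/-- With positive weights only the trivial monomial has degree zero, so `f` is a constant. -/
lemma exists_mul_eq_one_of_degree_zero (ha : ∀ s, 0 < a s)
    (hf : IsWeightedHomogeneous (fun s => (a s : ℤ)) f 0) (h0 : f ≠ 0) : ∃ u, u * f = 1 := by
  classical
  have hC : f = C (coeff 0 f) := by
    ext c
    rw [coeff_C]
    split_ifs with h
    · rw [h]
    · by_contra hc
      have h1 := hf hc
      rw [Finsupp.weight_apply, Finsupp.sum,
        Finset.sum_eq_zero_iff_of_nonneg (fun i _ => by positivity)] at h1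
      apply h
      ext i
      by_contra hi
      have h2 := h1 i (Finsupp.mem_support_iff.2 (Ne.symm hi))
      have h3 := ha i
      simp only [nsmul_eq_mul, mul_eq_zero, Nat.cast_eq_zero] at h2
      rcases h2 with h2 | h2
      · exact hi h2.symm
      · omega
  have hne : coeff 0 f ≠ 0 := fun h => h0 (by rw [hC, h, C_0])
  refine ⟨C (coeff 0 f)⁻¹, ?_⟩
  conv_lhs => rw [hC]
  rw [← C_mul, coeff_zero_C, inv_mul_cancel₀ hne, C_1]

lemma eval_zero_of_degree_ne_zero (hf : IsWeightedHomogeneous (fun s => (a s : ℤ)) f d)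
    (hd : d ≠ 0) : eval 0 f = 0 := by
  have : eval (0 : σ → ℂ) f = coeff 0 f := by
    rw [← constantCoeff_eq]; simp
  rw [this]
  by_contra h
  exact hd (by simpa using (hf h).symm)

end Homogeneous

namespace IsQuasismoothC2Pullback

variable {a : Fin 8 → ℕ} {ρ ρE : Fin 3 → ℤ} {φ : C2Var → MvPolynomial (Fin 8) ℂ}

lemma eq_zero (H : IsQuasismoothC2Pullback a ρ ρE φ) {v : C2Var} (h : degree ρ ρE v < 0) :
    φ v = 0 := eq_zero_of_degree_neg (H.homogeneous v) h

lemma exists_inv (H : IsQuasismoothC2Pullback a ρ ρE φ) {v : C2Var} (h : degree ρ ρE v = 0) :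
    ∃ u, u * φ v = 1 :=
  exists_mul_eq_one_of_degree_zero H.weight_pos (h ▸ H.homogeneous v) (H.ne_zero v h)

lemma eval_zero (H : IsQuasismoothC2Pullback a ρ ρE φ) {v : C2Var} (h : degree ρ ρE v ≠ 0) :
    eval 0 (φ v) = 0 := eval_zero_of_degree_ne_zero (H.homogeneous v) h

/-- Symmetries of the format. -/
lemma comp (H : IsQuasismoothC2Pullback a ρ ρE φ) {ρ' ρE' : Fin 3 → ℤ} (σ : C2Var → C2Var)
    (τ : Rel → Rel) (hτ : Function.Surjective τ)
    (hσ : ∀ r, rename σ (equation r) = equation (τ r))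
    (hd : ∀ v, degree ρ' ρE' v = degree ρ ρE (σ v)) :
    IsQuasismoothC2Pullback a ρ' ρE' (φ ∘ σ) := by
  have hI : c2PullbackIdeal (φ ∘ σ) = c2PullbackIdeal φ := by
    unfold c2PullbackIdeal
    rw [show (fun r => aeval (φ ∘ σ) (equation r)) = (fun r => aeval φ (equation r)) ∘ τ from ?_,
      hτ.range_comp]
    ext1 r
    rw [Function.comp_apply, ← hσ, aeval_rename]
  refine ⟨H.weight_pos, fun v => ?_, fun v hv => H.ne_zero _ (hd v ▸ hv), ?_, ?_, ?_⟩
  · rw [hd]; exact H.homogeneous _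
  · unfold IsC2RegularPullback; rw [hI]; exact H.regular
  · rw [hI]; exact H.nonsingular
  · rw [hI]; exact H.not_ci

lemma exists_shift (H : IsQuasismoothC2Pullback a ρ ρE φ) (m : Fin 3) :
    ∃ ρ' ρE' φ', IsQuasismoothC2Pullback a ρ' ρE' φ' ∧
      ∀ v, degree ρ' ρE' v = degree ρ ρE (v.shift m) := by
  have hd : ∀ v, degree (fun i => ρ (i + m)) (fun i => ρE (i + m)) v
      = degree ρ ρE (v.shift m) := by
    rintro (i | i | i | i | _) <;> simp only [degree, C2Var.shift, add_right_comm _ m]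
    exact congrArg₂ _ (Equiv.sum_comp (Equiv.addRight m) ρE) (Equiv.sum_comp (Equiv.addRight m) ρ)
  refine ⟨_, _, _, H.comp (C2Var.shift m)
    (fun r => match r with
      | .vertex i => .vertex (i + m) | .edge i => .edge (i + m) | .mixed i => .mixed (i + m))
    ?_ ?_ hd, hd⟩
  · rintro (i | i | i)
    · exact ⟨.vertex (i - m), by simp⟩
    · exact ⟨.edge (i - m), by simp⟩
    · exact ⟨.mixed (i - m), by simp⟩
  · rintro (i | i | i) <;> simp [equation, C2Var.shift, add_right_comm]

lemma exists_reflect (H : IsQuasismoothC2Pullback a ρ ρE φ) :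
    ∃ ρ' ρE' φ', IsQuasismoothC2Pullback a ρ' ρE' φ' ∧
      ∀ v, degree ρ' ρE' v = degree ρ ρE v.reflect := by
  have hd : ∀ v, degree (fun i => ρ (1 - i)) (fun i => ρE (-i)) v = degree ρ ρE v.reflect := by
    rintro (i | i | i | i | _)
    any_goals fin_cases i
    all_goals simp [degree, C2Var.reflect, Fin.sum_univ_three, show (-1 : Fin 3) = 2 from rfl,
      show (-2 : Fin 3) = 1 from rfl]
    all_goals ring
  refine ⟨_, _, _, H.comp C2Var.reflect
    (fun r => match r with
      | .vertex i => .vertex (-i) | .edge i => .edge (1 - i) | .mixed i => .mixed (1 - i))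
    ?_ ?_ hd, hd⟩
  · rintro (i | i | i)
    · exact ⟨.vertex (-i), by simp⟩
    · exact ⟨.edge (1 - i), by simp⟩
    · exact ⟨.mixed (1 - i), by simp⟩
  · rintro (i | i | i) <;> fin_cases i <;>
      simp [equation, C2Var.reflect, show (-1 : Fin 3) = 2 from rfl,
        show (-2 : Fin 3) = 1 from rfl] <;> ring

/-- If all equations follow from four of them, there is a contradiction. -/
lemma false_of_four_generators (H : IsQuasismoothC2Pullback a ρ ρE φ) (f : Fin 4 → Rel)
    (hf : ∀ (B : Type) [CommRing B] [Algebra ℂ B] (π : MvPolynomial (Fin 8) ℂ →ₐ[ℂ] B),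
      (∀ i, aeval (π ∘ φ) (equation (f i)) = 0) → ∀ r, aeval (π ∘ φ) (equation r) = 0) : False := by
  apply H.not_ci
  refine ⟨4, fun i => aeval φ (equation (f i)), H.regular, le_antisymm ?_ ?_⟩
  · unfold c2PullbackIdeal
    rw [Ideal.span_le]
    rintro _ ⟨r, rfl⟩
    -- Modulo `J` the four chosen equations hold exactly, so the hypothesis applies to the quotient
    -- ring.
    set J := Ideal.span (Set.range fun i => aeval φ (equation (f i)))
    have key : ∀ r, aeval (Ideal.Quotient.mkₐ ℂ J ∘ φ) (equation r)
        = Ideal.Quotient.mk J (aeval φ (equation r)) := fun r => by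
      exact (comp_aeval_apply φ (Ideal.Quotient.mkₐ ℂ J) _).symm
    have h1 := hf _ (Ideal.Quotient.mkₐ ℂ J) (fun i => by
      rw [key, Ideal.Quotient.eq_zero_iff_mem]
      exact Ideal.subset_span ⟨i, rfl⟩) r
    rwa [key, Ideal.Quotient.eq_zero_iff_mem] at h1
  · rw [Ideal.span_le]
    rintro _ ⟨i, rfl⟩
    exact Ideal.subset_span ⟨f i, rfl⟩

/-- If, along the zero locus of seven polynomials vanishing at the origin, the gradients of all
equations are spanned by three polynomials, there is a contradiction. -/
lemma false_of_singular_locus (H : IsQuasismoothC2Pullback a ρ ρE φ)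
    (g : Fin 7 → MvPolynomial (Fin 8) ℂ) (hg : ∀ i, eval 0 (g i) = 0) (h :
      Fin 3 → MvPolynomial (Fin 8) ℂ)
    (hp : ∀ (p : Fin 8 → ℂ) (T : Submodule ℂ (Fin 8 → ℂ)), (∀ i, eval p (g i) = 0) →
      (∀ i, gradientAt p (h i) ∈ T) →
        ∀ r, aeval φ (equation r) ∈ idealOfGradients p T) : False := by
  obtain ⟨p, hp0, hpg⟩ := exists_common_zero_ne_zero (by norm_num) g hg
  refine not_isNonsingularOutsideVertex (c := 4) (k := 3) (c2PullbackIdeal φ)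
    (by rw [H.regular]; rfl) (by norm_num) p hp0 h ?_ H.nonsingular
  unfold c2PullbackIdeal
  rw [Ideal.span_le]
  rintro _ ⟨r, rfl⟩
  exact hp p _ hpg (fun i => Submodule.subset_span (Set.mem_range_self i)) r

end IsQuasismoothC2Pullback

lemma mem_idealOfGradients_of_gradientAt_eq_zero {n : ℕ} {p : Fin n → ℂ}
    {T : Submodule ℂ (Fin n → ℂ)} {f : MvPolynomial (Fin n) ℂ} (hf : eval p f = 0)
    (h : gradientAt p f = 0) : f ∈ idealOfGradients p T :=
  ⟨hf, h ▸ T.zero_mem⟩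

lemma AlgHom.map_mul_eq_one {B B' : Type*} [CommRing B] [Algebra ℂ B] [CommRing B'] [Algebra ℂ B']
    (π : B →ₐ[ℂ] B') {u f : B} (hu : u * f = 1) : π u * π f = 1 := by
  rw [← map_mul, hu, map_one]

/-! ### Excluding degrees: units, then negative degrees when no `A_ij` is a unit. -/

namespace IsQuasismoothC2Pullback

variable {a : Fin 8 → ℕ} {ρ ρE : Fin 3 → ℤ} {φ : C2Var → MvPolynomial (Fin 8) ℂ}

lemma degree_theta_zero_ne_zero (H : IsQuasismoothC2Pullback a ρ ρE φ) :
    degree ρ ρE (theta 0) ≠ 0 := by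
  intro h
  obtain ⟨u, hu⟩ := H.exists_inv h
  refine H.false_of_four_generators ![.vertex 0, .vertex 2, .edge 0, .mixed 0]
    fun B _ _ π hπ => ?_
  have hu : π u * (π ∘ φ) (theta 0) = 1 := π.map_mul_eq_one hu
  have v0 := (aeval_equation_vertex_zero (π ∘ φ)).symm.trans (hπ 0)
  have v2 := (aeval_equation_vertex_two (π ∘ φ)).symm.trans (hπ 1)
  have e0 := (aeval_equation_edge_zero (π ∘ φ)).symm.trans (hπ 2)
  have m0 := (aeval_equation_mixed_zero (π ∘ φ)).symm.trans (hπ 3)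
  obtain ⟨h1, h2, h3, h4, h5⟩ := relations_of_theta_unit hu v0 v2 e0 m0
  apply forall_aeval_equation (P := fun b => b = 0) <;> assumption

lemma degree_thetaE_zero_ne_zero (H : IsQuasismoothC2Pullback a ρ ρE φ) :
    degree ρ ρE (thetaE 0) ≠ 0 := by
  intro h
  obtain ⟨u, hu⟩ := H.exists_inv h
  refine H.false_of_four_generators ![.vertex 0, .edge 0, .edge 1, .mixed 2]
    fun B _ _ π hπ => ?_
  have hu : π u * (π ∘ φ) (thetaE 0) = 1 := π.map_mul_eq_one hu
  have v0 := (aeval_equation_vertex_zero (π ∘ φ)).symm.trans (hπ 0)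
  have e0 := (aeval_equation_edge_zero (π ∘ φ)).symm.trans (hπ 1)
  have e1 := (aeval_equation_edge_one (π ∘ φ)).symm.trans (hπ 2)
  have m2 := (aeval_equation_mixed_two (π ∘ φ)).symm.trans (hπ 3)
  obtain ⟨h1, h2, h3, h4, h5⟩ := relations_of_thetaE_unit hu v0 e0 e1 m2
  apply forall_aeval_equation (P := fun b => b = 0) <;> assumption

lemma degree_AE_one_ne_zero (H : IsQuasismoothC2Pullback a ρ ρE φ) (h0 : degree ρ ρE (AE 0) = 0) :
    degree ρ ρE (AE 1) ≠ 0 := by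
  intro h
  obtain ⟨u, hu⟩ := H.exists_inv h0
  obtain ⟨w, hw⟩ := H.exists_inv h
  refine H.false_of_four_generators ![.vertex 0, .vertex 1, .vertex 2, .mixed 1]
    fun B _ _ π hπ => ?_
  have hu : π u * (π ∘ φ) (AE 0) = 1 := π.map_mul_eq_one hu
  have hw : π w * (π ∘ φ) (AE 1) = 1 := π.map_mul_eq_one hw
  have v0 := (aeval_equation_vertex_zero (π ∘ φ)).symm.trans (hπ 0)
  have v1 := (aeval_equation_vertex_one (π ∘ φ)).symm.trans (hπ 1)
  have v2 := (aeval_equation_vertex_two (π ∘ φ)).symm.trans (hπ 2)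
  have m1 := (aeval_equation_mixed_one (π ∘ φ)).symm.trans (hπ 3)
  obtain ⟨m0, e2⟩ := relations_of_two_AE_units hw v1 v2 m1
  obtain ⟨h1, h2, h3⟩ := relations_of_AE_unit hu v0 v1 v2 m0 m1
  apply forall_aeval_equation (P := fun b => b = 0) <;> assumption

lemma degree_A_zero_ne_zero (H : IsQuasismoothC2Pullback a ρ ρE φ) (h0 : degree ρ ρE (AE 0) = 0) :
    degree ρ ρE (A 0) ≠ 0 := by
  intro h
  obtain ⟨u, hu⟩ := H.exists_inv h0
  obtain ⟨w, hw⟩ := H.exists_inv h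
  refine H.false_of_four_generators ![.vertex 0, .vertex 1, .mixed 1, .edge 2]
    fun B _ _ π hπ => ?_
  have hu : π u * (π ∘ φ) (AE 0) = 1 := π.map_mul_eq_one hu
  have hw : π w * (π ∘ φ) (A 0) = 1 := π.map_mul_eq_one hw
  have v0 := (aeval_equation_vertex_zero (π ∘ φ)).symm.trans (hπ 0)
  have v1 := (aeval_equation_vertex_one (π ∘ φ)).symm.trans (hπ 1)
  have m1 := (aeval_equation_mixed_one (π ∘ φ)).symm.trans (hπ 2)
  have e2 := (aeval_equation_edge_two (π ∘ φ)).symm.trans (hπ 3)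
  obtain ⟨v2, m0⟩ := relations_of_AE_unit_of_A_unit hu hw v1 m1 e2
  obtain ⟨h1, h2, h3⟩ := relations_of_AE_unit hu v0 v1 v2 m0 m1
  apply forall_aeval_equation (P := fun b => b = 0) <;> assumption

/-- With `θ_1 = 0` and the seven chosen polynomials vanishing at `p`, every term is zero or has two
vanishing factors, except `A_23 θ_23`, `θ_12 θ_23` and `θ_23 θ_31`. These lie in three equations,
whose gradients span `T`. The next three lemmas follow the same pattern. -/
lemma degree_theta_zero_nonneg (H : IsQuasismoothC2Pullback a ρ ρE φ)
    (h0 : ∀ i, degree ρ ρE (AE i) ≠ 0) (h1 : ∀ i, degree ρ ρE (theta i) ≠ 0)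
    (h2 : ∀ i, degree ρ ρE (thetaE i) ≠ 0) :
    0 ≤ degree ρ ρE (theta 0) := by
  by_contra! h
  have hz := H.eq_zero h
  refine H.false_of_singular_locus
    ![φ (AE 0), φ (AE 1), φ (AE 2), φ (thetaE 2), φ (thetaE 0), φ (theta 1), φ (theta 2)]
    ?_
    ![aeval φ (equation (.vertex 1)), aeval φ (equation (.edge 1)), aeval φ (equation (.edge 2))]
    fun p T hp hT => ?_
  · simp only [Fin.forall_fin_succ, Matrix.cons_val_zero, Matrix.cons_val_succ, IsEmpty.forall_iff,
      and_true]
    refine ⟨H.eval_zero (h0 _), H.eval_zero (h0 _), H.eval_zero (h0 _), H.eval_zero (h2 _),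
      H.eval_zero (h2 _), H.eval_zero (h1 _), H.eval_zero (h1 _)⟩
  · simp only [Fin.forall_fin_succ, Matrix.cons_val_zero, Matrix.cons_val_succ, IsEmpty.forall_iff,
      and_true, aeval_equation_vertex_one, aeval_equation_edge_one,
        aeval_equation_edge_two] at hp hT
    obtain ⟨p0, p1, p2, p3, p4, p5, p6⟩ := hp
    obtain ⟨t_v1, t_e1, t_e2⟩ := hT
    -- For the three equations paired with a gradient hypothesis only the value at `p` remains to be
    -- checked; for the other six both value and gradient vanish.
    refine forall_aeval_equation _ ?_ ⟨?_, t_v1⟩ ?_ ?_ ⟨?_, t_e1⟩ ⟨?_, t_e2⟩ ?_ ?_ ?_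
    all_goals try apply mem_idealOfGradients_of_gradientAt_eq_zero
    all_goals simp [gradientAt_mul, pow_two, hz, p0, p1, p2, p3, p4, p5, p6]

lemma degree_thetaE_zero_nonneg (H : IsQuasismoothC2Pullback a ρ ρE φ)
    (h0 : ∀ i, degree ρ ρE (AE i) ≠ 0) (h1 : ∀ i, degree ρ ρE (theta i) ≠ 0)
    (h2 : ∀ i, degree ρ ρE (thetaE i) ≠ 0) :
    0 ≤ degree ρ ρE (thetaE 0) := by
  by_contra! h
  have hz := H.eq_zero h
  refine H.false_of_singular_locus
    ![φ (AE 0), φ (AE 1), φ (AE 2), φ (theta 0), φ (theta 1), φ (theta 2), φ (thetaE 2)]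
    ?_
    ![aeval φ (equation (.vertex 1)), aeval φ (equation (.edge 2)), aeval φ (equation (.mixed 0))]
    fun p T hp hT => ?_
  · simp only [Fin.forall_fin_succ, Matrix.cons_val_zero, Matrix.cons_val_succ, IsEmpty.forall_iff,
      and_true]
    refine ⟨H.eval_zero (h0 _), H.eval_zero (h0 _), H.eval_zero (h0 _), H.eval_zero (h1 _),
      H.eval_zero (h1 _), H.eval_zero (h1 _), H.eval_zero (h2 _)⟩
  · simp only [Fin.forall_fin_succ, Matrix.cons_val_zero, Matrix.cons_val_succ, IsEmpty.forall_iff,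
      and_true, aeval_equation_vertex_one, aeval_equation_edge_two,
        aeval_equation_mixed_zero] at hp hT
    obtain ⟨p0, p1, p2, p3, p4, p5, p6⟩ := hp
    obtain ⟨t_v1, t_e2, t_m0⟩ := hT
    refine forall_aeval_equation _ ?_ ⟨?_, t_v1⟩ ?_ ?_ ?_ ⟨?_, t_e2⟩ ⟨?_, t_m0⟩ ?_ ?_
    all_goals try apply mem_idealOfGradients_of_gradientAt_eq_zero
    all_goals simp [gradientAt_mul, pow_two, hz, p0, p1, p2, p3, p4, p5, p6]

lemma degree_AE_zero_nonneg (H : IsQuasismoothC2Pullback a ρ ρE φ)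
    (h0 : ∀ i, degree ρ ρE (AE i) ≠ 0) (h1 : ∀ i, degree ρ ρE (theta i) ≠ 0)
    (h2 : ∀ i, degree ρ ρE (thetaE i) ≠ 0) :
    0 ≤ degree ρ ρE (AE 0) := by
  by_contra! h
  have hz := H.eq_zero h
  refine H.false_of_singular_locus
    ![φ (theta 0), φ (theta 1), φ (theta 2), φ (AE 1), φ (AE 2), φ (thetaE 1), φ (thetaE 2)]
    ?_
    ![aeval φ (equation (.mixed 2)), aeval φ (equation (.edge 0)), aeval φ (equation (.edge 1))]
    fun p T hp hT => ?_
  · simp only [Fin.forall_fin_succ, Matrix.cons_val_zero, Matrix.cons_val_succ, IsEmpty.forall_iff,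
      and_true]
    refine ⟨H.eval_zero (h1 _), H.eval_zero (h1 _), H.eval_zero (h1 _), H.eval_zero (h0 _),
      H.eval_zero (h0 _), H.eval_zero (h2 _), H.eval_zero (h2 _)⟩
  · simp only [Fin.forall_fin_succ, Matrix.cons_val_zero, Matrix.cons_val_succ, IsEmpty.forall_iff,
      and_true, aeval_equation_mixed_two, aeval_equation_edge_zero,
        aeval_equation_edge_one] at hp hT
    obtain ⟨p0, p1, p2, p3, p4, p5, p6⟩ := hp
    obtain ⟨t_m2, t_e0, t_e1⟩ := hT
    refine forall_aeval_equation _ ?_ ?_ ?_ ⟨?_, t_e0⟩ ⟨?_, t_e1⟩ ?_ ?_ ?_ ⟨?_, t_m2⟩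
    all_goals try apply mem_idealOfGradients_of_gradientAt_eq_zero
    all_goals simp [gradientAt_mul, pow_two, hz, p0, p1, p2, p3, p4, p5, p6]

/-- The polynomial `φ lam` must be among the seven, to kill the term `λ A_23 θ_1` to second order;
hence the condition `d(λ) ≠ 0`, without which `d(A_i) < 0` is permitted. -/
lemma degree_A_zero_nonneg (H : IsQuasismoothC2Pullback a ρ ρE φ)
    (h0 : ∀ i, degree ρ ρE (AE i) ≠ 0) (h1 : ∀ i, degree ρ ρE (theta i) ≠ 0)
    (h2 : ∀ i, degree ρ ρE (thetaE i) ≠ 0) (hl : degree ρ ρE lam ≠ 0) :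
    0 ≤ degree ρ ρE (A 0) := by
  by_contra! h
  have hz := H.eq_zero h
  refine H.false_of_singular_locus
    ![φ (AE 1), φ (theta 1), φ (theta 2), φ (thetaE 0), φ (thetaE 2), φ (thetaE 1), φ lam]
    ?_
    ![aeval φ (equation (.vertex 0)), aeval φ (equation (.vertex 2)),
      aeval φ (equation (.mixed 0))]
    fun p T hp hT => ?_
  · simp only [Fin.forall_fin_succ, Matrix.cons_val_zero, Matrix.cons_val_succ, IsEmpty.forall_iff,
      and_true]
    refine ⟨H.eval_zero (h0 _), H.eval_zero (h1 _), H.eval_zero (h1 _), H.eval_zero (h2 _),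
      H.eval_zero (h2 _), H.eval_zero (h2 _), H.eval_zero hl⟩
  · simp only [Fin.forall_fin_succ, Matrix.cons_val_zero, Matrix.cons_val_succ, IsEmpty.forall_iff,
      and_true, aeval_equation_vertex_zero, aeval_equation_vertex_two,
        aeval_equation_mixed_zero] at hp hT
    obtain ⟨p0, p1, p2, p3, p4, p5, p6⟩ := hp
    obtain ⟨t_v0, t_v2, t_m0⟩ := hT
    refine forall_aeval_equation _ ⟨?_, t_v0⟩ ?_ ⟨?_, t_v2⟩ ?_ ?_ ?_ ⟨?_, t_m0⟩ ?_ ?_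
    all_goals try apply mem_idealOfGradients_of_gradientAt_eq_zero
    all_goals simp [gradientAt_mul, pow_two, hz, p0, p1, p2, p3, p4, p5, p6]

end IsQuasismoothC2Pullback

/-! ### The Pfaffian case: `A_12` is a unit. -/

/-- The tenth entry of the `5 × 5` skew matrix to which the format reduces when `A₁₂` is a unit. -/
noncomputable def c2SkewEntry (φ : C2Var → MvPolynomial (Fin 8) ℂ) : MvPolynomial (Fin 8) ℂ :=
  φ lam * φ (AE 0) + φ (A 2) * φ (theta 2)

/-- The five Pfaffians to which, up to one further equation, the format reduces when `A₁₂` is a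
unit. -/
noncomputable def c2Pfaffian (φ : C2Var → MvPolynomial (Fin 8) ℂ) :
    Fin 5 → MvPolynomial (Fin 8) ℂ :=
  ![φ (theta 1) * φ (theta 2) - φ (AE 1) * φ (thetaE 1) - φ (AE 2) * φ (A 0) * φ (AE 0),
    φ (theta 2) * φ (theta 0) - φ (AE 2) * φ (thetaE 2) - φ (AE 0) * φ (A 1) * φ (AE 1),
    φ (theta 0) * φ (thetaE 1) - φ (AE 0) * φ (A 1) * φ (theta 1) - φ (AE 2) * c2SkewEntry φ,
    φ (theta 1) * φ (thetaE 2) - φ (A 0) * φ (AE 0) * φ (theta 0) - φ (AE 1) * c2SkewEntry φ,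
    φ (thetaE 1) * φ (thetaE 2) - φ (theta 2) * c2SkewEntry φ - φ (A 0) * φ (AE 0) ^ 2 * φ (A 1)]

lemma forall_aeval_equation_eq_zero_of_AE_unit {B : Type*} [CommRing B] [Algebra ℂ B]
    (x : C2Var → B) {u : B} (hu : u * x (AE 0) = 1)
    (v0 : aeval x (equation (.vertex 0)) = 0) (v1 : aeval x (equation (.vertex 1)) = 0)
    (v2 : aeval x (equation (.vertex 2)) = 0) (m0 : aeval x (equation (.mixed 0)) = 0)
    (m1 : aeval x (equation (.mixed 1)) = 0) (e2 : aeval x (equation (.edge 2)) = 0) :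
    ∀ r, aeval x (equation r) = 0 := by
  rw [aeval_equation_vertex_zero] at v0
  rw [aeval_equation_vertex_one] at v1
  rw [aeval_equation_vertex_two] at v2
  rw [aeval_equation_mixed_zero] at m0
  rw [aeval_equation_mixed_one] at m1
  rw [aeval_equation_edge_two] at e2
  obtain ⟨h1, h2, h3⟩ := relations_of_AE_unit hu v0 v1 v2 m0 m1
  apply forall_aeval_equation (P := fun b => b = 0) <;> assumption

namespace IsQuasismoothC2Pullback

variable {a : Fin 8 → ℕ} {ρ ρE : Fin 3 → ℤ} {φ : C2Var → MvPolynomial (Fin 8) ℂ}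

/-- If `A₁₂` is a unit, it is enough to control the five Pfaffians. -/
lemma false_of_AE_unit_of_singular_locus (H : IsQuasismoothC2Pullback a ρ ρE φ)
    (h0 : degree ρ ρE (AE 0) = 0) (h1 : ∀ i, degree ρ ρE (theta i) ≠ 0)
    (h2 : ∀ i, degree ρ ρE (thetaE i) ≠ 0) (hb1 : degree ρ ρE (AE 1) ≠ 0)
    (g : Fin 6 → MvPolynomial (Fin 8) ℂ) (hg : ∀ i, eval 0 (g i) = 0) (h : Fin 2 → Fin 5)
    (hp : ∀ (p : Fin 8 → ℂ) (T : Submodule ℂ (Fin 8 → ℂ)), (∀ i, eval p (g i) = 0) →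
      (∀ i, gradientAt p (c2Pfaffian φ (h i)) ∈ T) →
        ∀ j, c2Pfaffian φ j ∈ idealOfGradients p T) : False := by
  obtain ⟨u, hu⟩ := H.exists_inv h0
  -- The equation eliminating `θ_12` takes one of the seven zero conditions and one of the three
  -- gradients, leaving six and two for the Pfaffians.
  refine H.false_of_singular_locus (Fin.cons (aeval φ (equation (.vertex 0))) g) ?_
    (Fin.cons (aeval φ (equation (.vertex 0))) fun i => c2Pfaffian φ (h i)) fun p T hpg hT => ?_
  · refine Fin.cases ?_ hg
    simp only [Fin.cons_zero, aeval_equation_vertex_zero, map_sub, map_add, map_mul,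
      H.eval_zero (h1 _), H.eval_zero (h2 _), H.eval_zero hb1]
    simp
  · have hpf := hp p T (fun i => by simpa using hpg i.succ) (fun i => by simpa using hT i.succ)
    have hv0 : aeval φ (equation (.vertex 0)) ∈ idealOfGradients p T := ⟨hpg 0, hT 0⟩
    set K := idealOfGradients p T
    have key : ∀ r, aeval (Ideal.Quotient.mkₐ ℂ K ∘ φ) (equation r)
        = Ideal.Quotient.mk K (aeval φ (equation r)) := fun r =>
      (comp_aeval_apply φ (Ideal.Quotient.mkₐ ℂ K) _).symm
    have hz : ∀ r, aeval φ (equation r) ∈ K →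
        aeval (Ideal.Quotient.mkₐ ℂ K ∘ φ) (equation r) = 0 := fun r hr => by
      rw [key, Ideal.Quotient.eq_zero_iff_mem]; exact hr
    suffices ∀ r, aeval (Ideal.Quotient.mkₐ ℂ K ∘ φ) (equation r) = 0 by
      intro r
      rw [← Ideal.Quotient.eq_zero_iff_mem, ← key]
      exact this r
    refine forall_aeval_equation_eq_zero_of_AE_unit _ ((Ideal.Quotient.mkₐ ℂ K).map_mul_eq_one hu)
      (hz _ hv0) (hz _ ?_) (hz _ ?_) (hz _ ?_) (hz _ ?_) (hz _ ?_)
    · convert hpf 0 using 1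
      simp only [aeval_equation_vertex_one, c2Pfaffian, c2SkewEntry, Matrix.cons_val]
      ring
    · convert hpf 1 using 1
      simp only [aeval_equation_vertex_two, c2Pfaffian, c2SkewEntry, Matrix.cons_val]
      ring
    · convert hpf 2 using 1
      simp only [aeval_equation_mixed_zero, c2Pfaffian, c2SkewEntry, Matrix.cons_val]
      ring
    · convert hpf 3 using 1
      simp only [aeval_equation_mixed_one, c2Pfaffian, c2SkewEntry, Matrix.cons_val]
      ring
    · convert hpf 4 using 1
      simp only [aeval_equation_edge_two, c2Pfaffian, c2SkewEntry, Matrix.cons_val]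
      ring

lemma eval_zero_c2SkewEntry (H : IsQuasismoothC2Pullback a ρ ρE φ)
    (h1 : ∀ i, degree ρ ρE (theta i) ≠ 0) (hl : degree ρ ρE lam ≠ 0) :
    eval 0 (c2SkewEntry φ) = 0 := by
  simp only [c2SkewEntry, map_add, map_mul, H.eval_zero hl, H.eval_zero (h1 2), zero_mul, mul_zero,
    add_zero]

/-- When `d(A_12) = 0` one has `d(A_3) = d(λ) - d(θ_3)`, so `A_3` or `θ_3` has negative degree. -/
lemma A_two_mul_theta_two_eq_zero (H : IsQuasismoothC2Pullback a ρ ρE φ)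
    (h0 : degree ρ ρE (AE 0) = 0) (h1 : ∀ i, degree ρ ρE (theta i) ≠ 0)
    (hl : degree ρ ρE lam ≤ 0) : φ (A 2) * φ (theta 2) = 0 := by
  have e1 : degree ρ ρE (A 2) = ρE 1 - 2 * ρ 2 + ρE 2 := rfl
  have e2 : degree ρ ρE (theta 2) = ρ 2 := rfl
  have e3 : degree ρ ρE (AE 0) = ρ 0 - ρE 0 + ρ 1 := rfl
  have e4 : degree ρ ρE lam = ρE 0 + ρE 1 + ρE 2 - (ρ 0 + ρ 1 + ρ 2) := by
    simp [degree, Fin.sum_univ_three]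
  have h12 := h1 2
  rcases lt_or_gt_of_ne h12 with h | h
  · rw [H.eq_zero h, mul_zero]
  · have : degree ρ ρE (A 2) < 0 := by omega
    rw [H.eq_zero this, zero_mul]

lemma degree_lam_ne_zero (H : IsQuasismoothC2Pullback a ρ ρE φ) (h0 : degree ρ ρE (AE 0) = 0)
    (h1 : ∀ i, degree ρ ρE (theta i) ≠ 0) :
    degree ρ ρE lam ≠ 0 := by
  intro h
  obtain ⟨u, hu₀⟩ := H.exists_inv h0
  obtain ⟨w, hw⟩ := H.exists_inv h
  refine H.false_of_four_generators ![.vertex 0, .mixed 0, .mixed 1, .edge 2]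
    fun B _ _ π hπ => ?_
  have hu : π u * (π ∘ φ) (AE 0) = 1 := π.map_mul_eq_one hu₀
  have v0 := (aeval_equation_vertex_zero (π ∘ φ)).symm.trans (hπ 0)
  have m0 := (aeval_equation_mixed_zero (π ∘ φ)).symm.trans (hπ 1)
  have m1 := (aeval_equation_mixed_one (π ∘ φ)).symm.trans (hπ 2)
  have e2 := (aeval_equation_edge_two (π ∘ φ)).symm.trans (hπ 3)
  -- Since `A_3 θ_3` vanishes, the tenth entry is the product of the units `λ` and `A_12`.
  have hw' : π (u * w) * ((π ∘ φ) lam * (π ∘ φ) (AE 0) + (π ∘ φ) (A 2) * (π ∘ φ) (theta 2)) = 1 := by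
    simp only [Function.comp_apply, ← map_mul, ← map_add]
    rw [H.A_two_mul_theta_two_eq_zero h0 h1 h.le, add_zero,
      show u * w * (φ lam * φ (AE 0)) = (u * φ (AE 0)) * (w * φ lam) by ring, hu₀, hw, one_mul,
      map_one]
  obtain ⟨v1, v2⟩ := relations_of_AE_unit_of_lam_unit hu hw' m0 m1 e2
  obtain ⟨h1, h2, h3⟩ := relations_of_AE_unit hu v0 v1 v2 m0 m1
  apply forall_aeval_equation (P := fun b => b = 0) <;> assumption

/-- The six chosen polynomials account for the entries sharing one index with the zero entry `θ_3`.
The three remaining entries are complementary to it, so the three Pfaffians containing `θ_3` vanish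
to second order at `p` and only two gradients survive. The following lemmas treat other entries in
this way. -/
lemma degree_theta_two_nonneg_of_AE_unit (H : IsQuasismoothC2Pullback a ρ ρE φ)
    (h0 : degree ρ ρE (AE 0) = 0) (h1 : ∀ i, degree ρ ρE (theta i) ≠ 0)
    (h2 : ∀ i, degree ρ ρE (thetaE i) ≠ 0) (hb1 : degree ρ ρE (AE 1) ≠ 0)
    (hb2 : degree ρ ρE (AE 2) ≠ 0) (ha0 : degree ρ ρE (A 0) ≠ 0) (ha1 : degree ρ ρE (A 1) ≠ 0) :
    0 ≤ degree ρ ρE (theta 2) := by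
  by_contra! h
  have hz := H.eq_zero h
  refine H.false_of_AE_unit_of_singular_locus h0 h1 h2 hb1
    ![φ (AE 1), φ (thetaE 1), φ (AE 2), φ (A 0), φ (thetaE 2), φ (A 1)]
    ?_ ![2, 3] fun p T hp hT => ?_
  · simp only [Fin.forall_fin_succ, Matrix.cons_val_zero, Matrix.cons_val_succ, IsEmpty.forall_iff,
      and_true]
    refine ⟨H.eval_zero hb1, H.eval_zero (h2 _), H.eval_zero hb2, H.eval_zero ha0,
      H.eval_zero (h2 _),
      H.eval_zero ha1⟩
  · simp only [Fin.forall_fin_succ, Matrix.cons_val_zero, Matrix.cons_val_succ, IsEmpty.forall_iff,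
      and_true] at hp hT ⊢
    obtain ⟨p0, p1, p2, p3, p4, p5⟩ := hp
    obtain ⟨t0, t1⟩ := hT
    refine ⟨?_, ?_, ⟨?_, t0⟩, ⟨?_, t1⟩, ?_⟩
    all_goals try apply mem_idealOfGradients_of_gradientAt_eq_zero
    all_goals simp [c2Pfaffian, gradientAt_mul, pow_two, hz, p0, p1, p2, p3, p4, p5]

lemma degree_lam_nonneg_of_AE_unit (H : IsQuasismoothC2Pullback a ρ ρE φ)
    (h0 : degree ρ ρE (AE 0) = 0) (h1 : ∀ i, degree ρ ρE (theta i) ≠ 0)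
    (h2 : ∀ i, degree ρ ρE (thetaE i) ≠ 0) (hb1 : degree ρ ρE (AE 1) ≠ 0)
    (ha0 : degree ρ ρE (A 0) ≠ 0) (ha1 : degree ρ ρE (A 1) ≠ 0) :
    0 ≤ degree ρ ρE lam := by
  by_contra! h
  have hz : c2SkewEntry φ = 0 := by
    rw [c2SkewEntry, H.eq_zero h, H.A_two_mul_theta_two_eq_zero h0 h1 h.le, zero_mul, add_zero]
  refine H.false_of_AE_unit_of_singular_locus h0 h1 h2 hb1
    ![φ (theta 0), φ (thetaE 1), φ (A 1), φ (theta 1), φ (thetaE 2), φ (A 0)]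
    ?_ ![0, 1] fun p T hp hT => ?_
  · simp only [Fin.forall_fin_succ, Matrix.cons_val_zero, Matrix.cons_val_succ, IsEmpty.forall_iff,
      and_true]
    refine ⟨H.eval_zero (h1 _), H.eval_zero (h2 _), H.eval_zero ha1, H.eval_zero (h1 _),
      H.eval_zero (h2 _), H.eval_zero ha0⟩
  · simp only [Fin.forall_fin_succ, Matrix.cons_val_zero, Matrix.cons_val_succ, IsEmpty.forall_iff,
      and_true] at hp hT ⊢
    obtain ⟨p0, p1, p2, p3, p4, p5⟩ := hp
    obtain ⟨t0, t1⟩ := hT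
    refine ⟨⟨?_, t0⟩, ⟨?_, t1⟩, ?_, ?_, ?_⟩
    all_goals try apply mem_idealOfGradients_of_gradientAt_eq_zero
    all_goals simp [c2Pfaffian, gradientAt_mul, pow_two, hz, p0, p1, p2, p3, p4, p5]

lemma degree_theta_zero_nonneg_of_AE_unit (H : IsQuasismoothC2Pullback a ρ ρE φ)
    (h0 : degree ρ ρE (AE 0) = 0) (h1 : ∀ i, degree ρ ρE (theta i) ≠ 0)
    (h2 : ∀ i, degree ρ ρE (thetaE i) ≠ 0) (hb1 : degree ρ ρE (AE 1) ≠ 0)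
    (hb2 : degree ρ ρE (AE 2) ≠ 0) (ha1 : degree ρ ρE (A 1) ≠ 0) (hl : degree ρ ρE lam ≠ 0) :
    0 ≤ degree ρ ρE (theta 0) := by
  by_contra! h
  have hz := H.eq_zero h
  refine H.false_of_AE_unit_of_singular_locus h0 h1 h2 hb1
    ![φ (AE 2), φ (thetaE 2), φ (A 1), φ (AE 1), φ (theta 1), c2SkewEntry φ]
    ?_ ![0, 4] fun p T hp hT => ?_
  · simp only [Fin.forall_fin_succ, Matrix.cons_val_zero, Matrix.cons_val_succ, IsEmpty.forall_iff,
      and_true]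
    refine ⟨H.eval_zero hb2, H.eval_zero (h2 _), H.eval_zero ha1, H.eval_zero hb1,
      H.eval_zero (h1 _),
      H.eval_zero_c2SkewEntry h1 hl⟩
  · simp only [Fin.forall_fin_succ, Matrix.cons_val_zero, Matrix.cons_val_succ, IsEmpty.forall_iff,
      and_true] at hp hT ⊢
    obtain ⟨p0, p1, p2, p3, p4, p5⟩ := hp
    obtain ⟨t0, t1⟩ := hT
    refine ⟨⟨?_, t0⟩, ?_, ?_, ?_, ⟨?_, t1⟩⟩
    all_goals try apply mem_idealOfGradients_of_gradientAt_eq_zero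
    all_goals simp [c2Pfaffian, gradientAt_mul, pow_two, hz, p0, p1, p2, p3, p4, p5]

lemma degree_thetaE_one_nonneg_of_AE_unit (H : IsQuasismoothC2Pullback a ρ ρE φ)
    (h0 : degree ρ ρE (AE 0) = 0) (h1 : ∀ i, degree ρ ρE (theta i) ≠ 0)
    (h2 : ∀ i, degree ρ ρE (thetaE i) ≠ 0) (hb1 : degree ρ ρE (AE 1) ≠ 0)
    (hb2 : degree ρ ρE (AE 2) ≠ 0) (ha0 : degree ρ ρE (A 0) ≠ 0) (ha1 : degree ρ ρE (A 1) ≠ 0)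
    (hl : degree ρ ρE lam ≠ 0) :
    0 ≤ degree ρ ρE (thetaE 1) := by
  by_contra! h
  have hz := H.eq_zero h
  refine H.false_of_AE_unit_of_singular_locus h0 h1 h2 hb1
    ![φ (theta 1), φ (theta 2), φ (AE 2), φ (A 0), φ (A 1), c2SkewEntry φ]
    ?_ ![1, 3] fun p T hp hT => ?_
  · simp only [Fin.forall_fin_succ, Matrix.cons_val_zero, Matrix.cons_val_succ, IsEmpty.forall_iff,
      and_true]
    refine ⟨H.eval_zero (h1 _), H.eval_zero (h1 _), H.eval_zero hb2, H.eval_zero ha0,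
      H.eval_zero ha1,
      H.eval_zero_c2SkewEntry h1 hl⟩
  · simp only [Fin.forall_fin_succ, Matrix.cons_val_zero, Matrix.cons_val_succ, IsEmpty.forall_iff,
      and_true] at hp hT ⊢
    obtain ⟨p0, p1, p2, p3, p4, p5⟩ := hp
    obtain ⟨t0, t1⟩ := hT
    refine ⟨?_, ⟨?_, t0⟩, ?_, ⟨?_, t1⟩, ?_⟩
    all_goals try apply mem_idealOfGradients_of_gradientAt_eq_zero
    all_goals simp [c2Pfaffian, gradientAt_mul, pow_two, hz, p0, p1, p2, p3, p4, p5]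

lemma degree_AE_one_nonneg_of_AE_unit (H : IsQuasismoothC2Pullback a ρ ρE φ)
    (h0 : degree ρ ρE (AE 0) = 0) (h1 : ∀ i, degree ρ ρE (theta i) ≠ 0)
    (h2 : ∀ i, degree ρ ρE (thetaE i) ≠ 0) (hb1 : degree ρ ρE (AE 1) ≠ 0)
    (hb2 : degree ρ ρE (AE 2) ≠ 0) (ha0 : degree ρ ρE (A 0) ≠ 0) :
    0 ≤ degree ρ ρE (AE 1) := by
  by_contra! h
  have hz := H.eq_zero h
  refine H.false_of_AE_unit_of_singular_locus h0 h1 h2 hb1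
    ![φ (theta 1), φ (theta 2), φ (AE 2), φ (A 0), φ (theta 0), φ (thetaE 2)]
    ?_ ![2, 4] fun p T hp hT => ?_
  · simp only [Fin.forall_fin_succ, Matrix.cons_val_zero, Matrix.cons_val_succ, IsEmpty.forall_iff,
      and_true]
    refine ⟨H.eval_zero (h1 _), H.eval_zero (h1 _), H.eval_zero hb2, H.eval_zero ha0,
      H.eval_zero (h1 _),
      H.eval_zero (h2 _)⟩
  · simp only [Fin.forall_fin_succ, Matrix.cons_val_zero, Matrix.cons_val_succ, IsEmpty.forall_iff,
      and_true] at hp hT ⊢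
    obtain ⟨p0, p1, p2, p3, p4, p5⟩ := hp
    obtain ⟨t0, t1⟩ := hT
    refine ⟨?_, ?_, ⟨?_, t0⟩, ?_, ⟨?_, t1⟩⟩
    all_goals try apply mem_idealOfGradients_of_gradientAt_eq_zero
    all_goals simp [c2Pfaffian, gradientAt_mul, pow_two, hz, p0, p1, p2, p3, p4, p5]

lemma degree_A_zero_nonneg_of_AE_unit (H : IsQuasismoothC2Pullback a ρ ρE φ)
    (h0 : degree ρ ρE (AE 0) = 0) (h1 : ∀ i, degree ρ ρE (theta i) ≠ 0)
    (h2 : ∀ i, degree ρ ρE (thetaE i) ≠ 0) (hb1 : degree ρ ρE (AE 1) ≠ 0)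
    (hl : degree ρ ρE lam ≠ 0) :
    0 ≤ degree ρ ρE (A 0) := by
  by_contra! h
  have hz := H.eq_zero h
  refine H.false_of_AE_unit_of_singular_locus h0 h1 h2 hb1
    ![φ (theta 1), φ (theta 2), φ (AE 1), φ (thetaE 1), φ (thetaE 2), c2SkewEntry φ]
    ?_ ![1, 2] fun p T hp hT => ?_
  · simp only [Fin.forall_fin_succ, Matrix.cons_val_zero, Matrix.cons_val_succ, IsEmpty.forall_iff,
      and_true]
    refine ⟨H.eval_zero (h1 _), H.eval_zero (h1 _), H.eval_zero hb1, H.eval_zero (h2 _),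
      H.eval_zero (h2 _), H.eval_zero_c2SkewEntry h1 hl⟩
  · simp only [Fin.forall_fin_succ, Matrix.cons_val_zero, Matrix.cons_val_succ, IsEmpty.forall_iff,
      and_true] at hp hT ⊢
    obtain ⟨p0, p1, p2, p3, p4, p5⟩ := hp
    obtain ⟨t0, t1⟩ := hT
    refine ⟨?_, ⟨?_, t0⟩, ⟨?_, t1⟩, ?_, ?_⟩
    all_goals try apply mem_idealOfGradients_of_gradientAt_eq_zero
    all_goals simp [c2Pfaffian, gradientAt_mul, pow_two, hz, p0, p1, p2, p3, p4, p5]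

end IsQuasismoothC2Pullback

/-! ### Transport by symmetry and the final case division. -/

namespace IsQuasismoothC2Pullback

variable {a : Fin 8 → ℕ} {ρ ρE : Fin 3 → ℤ} {φ : C2Var → MvPolynomial (Fin 8) ℂ}

lemma degree_theta_ne_zero (H : IsQuasismoothC2Pullback a ρ ρE φ) (i : Fin 3) :
    degree ρ ρE (theta i) ≠ 0 := by
  obtain ⟨ρ', ρE', φ', H', hd⟩ := H.exists_shift i
  simpa [hd, C2Var.shift] using H'.degree_theta_zero_ne_zero

lemma degree_thetaE_ne_zero (H : IsQuasismoothC2Pullback a ρ ρE φ) (i : Fin 3) :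
    degree ρ ρE (thetaE i) ≠ 0 := by
  obtain ⟨ρ', ρE', φ', H', hd⟩ := H.exists_shift i
  simpa [hd, C2Var.shift] using H'.degree_thetaE_zero_ne_zero

lemma degree_pos_of_AE_ne_zero (H : IsQuasismoothC2Pullback a ρ ρE φ)
    (h0 : ∀ i, degree ρ ρE (AE i) ≠ 0) (i : Fin 3) :
    0 < degree ρ ρE (theta i) ∧ 0 < degree ρ ρE (thetaE i) ∧ 0 < degree ρ ρE (AE i) := by
  obtain ⟨ρ', ρE', φ', H', hd⟩ := H.exists_shift i
  have h0' : ∀ j, degree ρ' ρE' (AE j) ≠ 0 := fun j => by rw [hd]; exact h0 _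
  have h1 := H'.degree_theta_zero_nonneg h0' H'.degree_theta_ne_zero H'.degree_thetaE_ne_zero
  have h2 := H'.degree_thetaE_zero_nonneg h0' H'.degree_theta_ne_zero H'.degree_thetaE_ne_zero
  have h3 := H'.degree_AE_zero_nonneg h0' H'.degree_theta_ne_zero H'.degree_thetaE_ne_zero
  simp only [hd, C2Var.shift, zero_add] at h1 h2 h3
  exact ⟨h1.lt_of_ne' (H.degree_theta_ne_zero i), h2.lt_of_ne' (H.degree_thetaE_ne_zero i),
    h3.lt_of_ne' (h0 i)⟩

lemma degree_A_nonneg (H : IsQuasismoothC2Pullback a ρ ρE φ)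
    (h0 : ∀ i, degree ρ ρE (AE i) ≠ 0) (hl : degree ρ ρE lam ≠ 0) (i : Fin 3) :
    0 ≤ degree ρ ρE (A i) := by
  obtain ⟨ρ', ρE', φ', H', hd⟩ := H.exists_shift i
  have h0' : ∀ j, degree ρ' ρE' (AE j) ≠ 0 := fun j => by rw [hd]; exact h0 _
  have h1 := H'.degree_A_zero_nonneg h0' H'.degree_theta_ne_zero H'.degree_thetaE_ne_zero
    (by rw [hd]; exact hl)
  simpa only [hd, C2Var.shift, zero_add] using h1

lemma degree_AE_two_ne_zero (H : IsQuasismoothC2Pullback a ρ ρE φ) (h0 : degree ρ ρE (AE 0) = 0) :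
    degree ρ ρE (AE 2) ≠ 0 := by
  obtain ⟨ρ', ρE', φ', H', hd⟩ := H.exists_reflect
  have := H'.degree_AE_one_ne_zero (by rw [hd]; exact h0)
  rwa [hd] at this

lemma degree_A_one_ne_zero (H : IsQuasismoothC2Pullback a ρ ρE φ) (h0 : degree ρ ρE (AE 0) = 0) :
    degree ρ ρE (A 1) ≠ 0 := by
  obtain ⟨ρ', ρE', φ', H', hd⟩ := H.exists_reflect
  have := H'.degree_A_zero_ne_zero (by rw [hd]; exact h0)
  rwa [hd] at this

lemma degree_pos_of_AE_zero (H : IsQuasismoothC2Pullback a ρ ρE φ) (h0 : degree ρ ρE (AE 0) = 0) :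
    0 < degree ρ ρE (theta 0) ∧ 0 < degree ρ ρE (thetaE 1) ∧ 0 < degree ρ ρE (AE 1) ∧
      0 < degree ρ ρE (A 0) ∧ 0 < degree ρ ρE (theta 2) ∧ 0 < degree ρ ρE lam := by
  have h1 := H.degree_theta_ne_zero
  have h2 := H.degree_thetaE_ne_zero
  have hb1 := H.degree_AE_one_ne_zero h0
  have hb2 := H.degree_AE_two_ne_zero h0
  have ha0 := H.degree_A_zero_ne_zero h0
  have ha1 := H.degree_A_one_ne_zero h0
  have hl := H.degree_lam_ne_zero h0 h1
  refine ⟨(H.degree_theta_zero_nonneg_of_AE_unit h0 h1 h2 hb1 hb2 ha1 hl).lt_of_ne' (h1 _),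
    (H.degree_thetaE_one_nonneg_of_AE_unit h0 h1 h2 hb1 hb2 ha0 ha1 hl).lt_of_ne' (h2 _),
    (H.degree_AE_one_nonneg_of_AE_unit h0 h1 h2 hb1 hb2 ha0).lt_of_ne' hb1,
    (H.degree_A_zero_nonneg_of_AE_unit h0 h1 h2 hb1 hl).lt_of_ne' ha0,
    (H.degree_theta_two_nonneg_of_AE_unit h0 h1 h2 hb1 hb2 ha0 ha1).lt_of_ne' (h1 _),
    (H.degree_lam_nonneg_of_AE_unit h0 h1 h2 hb1 ha0 ha1).lt_of_ne' hl⟩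

lemma forall_degree_pos_of_AE_eq_zero (H : IsQuasismoothC2Pullback a ρ ρE φ) (m : Fin 3)
    (h0 : degree ρ ρE (AE m) = 0) :
    (∀ i, 0 < degree ρ ρE (theta i)) ∧ (∀ i, 0 < degree ρ ρE (thetaE i)) ∧
      0 < degree ρ ρE (A m) ∧ 0 < degree ρ ρE (AE (m + 1)) ∧ 0 < degree ρ ρE (AE (m + 2)) ∧
        0 < degree ρ ρE (A (m + 1)) ∧ 0 < degree ρ ρE lam := by
  obtain ⟨ρ₁, ρE₁, φ₁, H₁, hd₁⟩ := H.exists_shift m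
  obtain ⟨ρ₂, ρE₂, φ₂, H₂, hd₂⟩ := H₁.exists_reflect
  have h1 : degree ρ₁ ρE₁ (AE 0) = 0 := by rw [hd₁]; simpa [C2Var.shift] using h0
  have h2 : degree ρ₂ ρE₂ (AE 0) = 0 := by rw [hd₂]; exact h1
  obtain ⟨t0, u1, b1, a0, t2, l⟩ := H₁.degree_pos_of_AE_zero h1
  obtain ⟨t1, u2, b2, a1, -, -⟩ := H₂.degree_pos_of_AE_zero h2
  rw [hd₂] at t1 u2 b2 a1
  -- `θ_12` is not an entry of the skew matrix; its degree is `d(θ_1) + d(θ_2)` because `d(A_12) =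
  -- 0`.
  have u0 : 0 < degree ρ₁ ρE₁ (thetaE 0) := by
    have e : degree ρ₁ ρE₁ (AE 0)
      = degree ρ₁ ρE₁ (theta 0) - degree ρ₁ ρE₁ (thetaE 0) + degree ρ₁ ρE₁ (theta 1) := rfl
    have t1 : 0 < degree ρ₁ ρE₁ (theta 1) := t1
    omega
  have ht : ∀ j, 0 < degree ρ₁ ρE₁ (theta j) := by
    intro j; fin_cases j
    exacts [t0, t1, t2]
  have hu : ∀ j, 0 < degree ρ₁ ρE₁ (thetaE j) := by
    intro j; fin_cases j
    exacts [u0, u1, u2]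
  refine ⟨fun i => ?_, fun i => ?_, ?_⟩
  · simpa [hd₁, C2Var.shift] using ht (i - m)
  · simpa [hd₁, C2Var.shift] using hu (i - m)
  · simp only [hd₁] at a0 b1 b2 a1 l
    rw [add_comm m 1, add_comm m 2]
    refine ⟨?_, b1, b2, a1, l⟩
    simpa [C2Var.shift] using a0

end IsQuasismoothC2Pullback

lemma C2Var.sum_degree_A (ρ ρE : Fin 3 → ℤ) :
    ∑ i, degree ρ ρE (A i) = 2 * degree ρ ρE lam := by
  simp [degree, Fin.sum_univ_three]
  ring

theorem mainTheorem4
    -- positive weights of the eight coordinates, and the grading of the format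
    (a : Fin 8 → ℕ) (ha : ∀ s, 0 < a s) (ρ ρE : Fin 3 → ℤ)
    -- a morphism `φ`, homogeneous of degree zero, with `φ^*(v)` nonzero whenever `d(v) = 0`
    (φ : C2Var → MvPolynomial (Fin 8) ℂ)
    (hφ : ∀ v, IsWeightedHomogeneous (fun s => (a s : ℤ)) (φ v) (degree ρ ρE v))
    (hφ0 : ∀ v, degree ρ ρE v = 0 → φ v ≠ 0)
    -- `φ⁻¹(X_{C₂})` is a regular pullback, quasismooth, and not a complete intersection
    (hreg : IsC2RegularPullback φ)
    (hqs : IsNonsingularOutsideVertex (c2PullbackIdeal φ))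
    (hci : ¬ IsCompleteIntersectionIdeal (c2PullbackIdeal φ)) :
    (∀ i, 0 < degree ρ ρE (theta i)) ∧ (∀ i, 0 < degree ρ ρE (thetaE i)) ∧
    ( -- `C₂` format
      ((∀ i, 0 < degree ρ ρE (AE i)) ∧ 0 < degree ρ ρE lam ∧ ∀ i, 0 ≤ degree ρ ρE (A i)) ∨
      -- `ℙ² × ℙ²` format
      ((∀ i, 0 < degree ρ ρE (AE i)) ∧ degree ρ ρE lam = 0 ∧
        ((∀ i, degree ρ ρE (A i) = 0) ∨ ∃ i, degree ρ ρE (A i) < 0)) ∨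
      -- `A₂ + CI⁽¹⁾` format; `(i, j, k) = (i, i + 1, i + 2)`
      (∃ i, degree ρ ρE (AE i) = 0 ∧
        0 < degree ρ ρE (A i) ∧ 0 < degree ρ ρE (AE (i + 1)) ∧ 0 < degree ρ ρE (AE (i + 2)) ∧
        0 < degree ρ ρE (A (i + 1)) ∧ 0 < degree ρ ρE lam)) := by
  have H : IsQuasismoothC2Pullback a ρ ρE φ := ⟨ha, hφ, hφ0, hreg, hqs, hci⟩
  by_cases h0 : ∃ m, degree ρ ρE (AE m) = 0
  · obtain ⟨m, hm⟩ := h0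
    obtain ⟨h1, h2, h3⟩ := H.forall_degree_pos_of_AE_eq_zero m hm
    exact ⟨h1, h2, Or.inr (Or.inr ⟨m, hm, h3⟩)⟩
  · push Not at h0
    have hpos := H.degree_pos_of_AE_ne_zero h0
    refine ⟨fun i => (hpos i).1, fun i => (hpos i).2.1, ?_⟩
    have hsum := C2Var.sum_degree_A ρ ρE
    by_cases hl : degree ρ ρE lam = 0
    · refine Or.inr (Or.inl ⟨fun i => (hpos i).2.2, hl, ?_⟩)
      by_cases hneg : ∃ i, degree ρ ρE (A i) < 0
      · exact Or.inr hneg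
      · push Not at hneg
        -- Non-negative degrees `d(A_i)` with sum `2 d(λ) = 0` are all zero.
        rw [hl, mul_zero, Finset.sum_eq_zero_iff_of_nonneg fun i _ => hneg i] at hsum
        exact Or.inl fun i => hsum i (Finset.mem_univ i)
    · have hA := H.degree_A_nonneg h0 hl
      have hnn := Finset.sum_nonneg fun i (_ : i ∈ Finset.univ) => hA i
      -- The sum `2 d(λ)` is non-negative and `d(λ) ≠ 0`, so `d(λ) > 0`.
      exact Or.inl ⟨fun i => (hpos i).2.2, by omega, hA⟩
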